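/- **Games and strategies.** A (parametrized) game $G$ consists of opponent moves and player moves, encoded as strings over a fixed alphabet, and, for every value $n\in\mathbb N$ of the security parameter, of a non-empty prefix-closed set of legal plays: finite sequences of alternating opponent and player moves, starting with an opponent move, whose encoded length is bounded by a polynomial in $n$. A strategy $\mathsf f$ on $G$ is a family of partial functions $\mathsf f_n$ from the legal plays of odd length to player moves such that $s\,\mathsf f_n(s)$ is legal for every $s\in\mathrm{dom}\,\mathsf f_n$, such that $sxy\in\mathrm{dom}\,\mathsf f_n$ implies $\mathsf f_n(s)=x$, and such that $sx\in\mathrm{dom}\,\mathsf f_n$ whenever $sx$ is legal and $s$ is a play of $\mathsf f$ (that is, $s$ is empty or $s=s'\mathsf f_n(s')$). It is polytime computable if a polynomial-time Turing machine maps $(1^n,s)$ to $\mathsf f_n(s)$ for all $s\in\mathrm{dom}\,\mathsf f_n$. In $\mathbf B$, $\mathbf S[p]$ and $\mathbf T[t]$ the opponent asks $?$ once and the player answers by a bit, by a string in $\{0,1\}^{p(n)}$, and by a string in $\{0,1,\bot\}^{t(n)}$, respectively; in $\mathbf O^{r}$ the opponent asks $?$ at most $r(n)$ times, each time getting a bit.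 Legal plays of $G\multimap H$ are the alternating sequences (with the two players exchanged in $G$) whose projections to $G$ and to $H$ are legal; in $!_pG$ at most $p(n)$ copies of $G$ are played, in interleaving, the copies being opened in the order of their indices. A polytime probabilistic strategy on $G$ is a polytime computable strategy on $\mathbf O^{r}\multimap G$ for some polynomial $r$; if $G$ is a ground game such as $\mathbf T[t]$, the probability of an answer $a$ is $\sum 2^{-k}$ over all sequences $b_1\dots b_k$ of oracle bits for which $?\cdot ?\,b_1\cdots ?\,b_k\cdot a$ is a play of the strategy. For polynomially bounded $p,q:\mathbb N\to\mathbb N$ let $\mathbf{SOF}_{q,p}={!_q}(\mathbf S[\iota]\multimap\mathbf B)\multimap\mathbf S[p]$, with $\iota(n)=n$. A strategy $\mathsf f$ on it computes the family $F_n:(\{0,1\}^n\to\{0,1\})\to\{0,1\}^{p(n)}$ for which, for all $n$ and $\varphi$, playing $\mathsf f$ against copies of the strategy that asks for its argument $w$ and then answers $\varphi(w)$ leads to the answer $F_n(\varphi)$. For a strategy $\mathsf f$ on $\mathbf{SOF}_{q,p}$ and a probabilistic strategy $\mathsf g$ on $!_s\mathbf{SOF}_{q,p}\multimap\mathbf T[t]$,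 the composition $\mathsf f;\mathsf g$ is the probabilistic strategy on $\mathbf T[t]$ obtained by playing $\mathsf g$ against $s(n)$ copies of $\mathsf f$ and hiding the moves of these copies. **Distributions.** A string $a\in\{0,1,\bot\}^N$ represents the partial function $g:[N]\rightharpoonup\{0,1\}$ that is undefined where $a$ is $\bot$; $U_g$ is the uniform distribution on the $x\in\{0,1\}^N$ that agree with $g$ on $\mathrm{dom}(g)$. If $N$ divides $2^n$, the extension of $x\in\{0,1\}^N$ is $f_x:\{0,1\}^n\to\{0,1\}$, $f_x(i)=x_{\lfloor i/(2^n/N)\rfloor+1}$, where $\{0,1\}^n$ is identified with $\{0,\dots,2^n-1\}$ in the natural way, and $f_{U_g}$ is the distribution of $f_x$ for $x\sim U_g$. For a distribution $\mathcal D$ and a function $F$ with values in strings, $\mathrm{Var}_{\mathcal D}(F)=\Pr_{x,y\sim\mathcal D}[F(x)\ne F(y)]$, with $x,y$ independent. **Theorem.** There is an absolute constant $C$ such that the following holds. Let $p,q,t:\mathbb N\to\mathbb N$ be polynomially bounded, with $1^n\mapsto 1^{t(n)}$ computable in polynomial time, and let $\varepsilon,\delta>0$. Then there are a polynomial $s$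 and a polytime probabilistic strategy $\mathsf{infvar}_{\varepsilon,\delta}$ on $!_s\mathbf{SOF}_{q,p}\multimap\mathbf T[t]$ such that, for every deterministic (not necessarily polytime) strategy $\mathsf f$ on $\mathbf{SOF}_{q,p}$ computing $\{F_n\}_{n\in\mathbb N}$ and every $n$ such that $t(n)$ divides $2^n$, the composition $\mathsf f;\mathsf{infvar}_{\varepsilon,\delta}$ outputs, with probability at least $1-\delta$, a partial function $g_n:[t(n)]\rightharpoonup\{0,1\}$ with $$\mathrm{Var}_{f_{U_{g_n}}}(F_n)\le\varepsilon\qquad\text{and}\qquad|\mathrm{dom}(g_n)|\le C\,\frac{p(n)\,q(n)^2}{\delta\,\varepsilon}.$$ -/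

import Mathlib

/-! Parametrized games, strategies, bounded exponentials, and semi-uniform distributions. -/

namespace ParamGames

noncomputable section

/-! ### Security-parameter functions -/

/-- Unary, total, polynomially bounded functions on the natural numbers. -/
structure Pol where
  toFun : ℕ → ℕ
  bound : ∃ P : Polynomial ℕ, ∀ n, toFun n ≤ P.eval n

instance : CoeFun Pol (fun _ => ℕ → ℕ) := ⟨Pol.toFun⟩

/-- The identity `ι`. -/
def Pol.iota : Pol := ⟨fun n => n, Polynomial.X, fun n => by simp⟩

def Pol.ofPolynomial (P : Polynomial ℕ) : Pol := ⟨fun n => P.eval n, P, fun _ => le_rfl⟩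

/-- `1 ^ n ↦ 1 ^ (t n)` is computed by a Turing machine in polynomial time. -/
def Pol.PolytimeComputable (t : Pol) : Prop :=
  Nonempty (Turing.TM2ComputableInPolyTime
    Computability.unaryEncodeNat Computability.unaryEncodeNat t.toFun)

/-! ### Games -/

/-- The fixed alphabet in which moves are encoded. -/
inductive Sym
  | bit (b : Bool)
  | bot
  | ask
  | ans
  | left
  | right
  | tick
  | sep
  deriving DecidableEq, Fintype

/-- `Alternates opp true s`: the moves of `s` alternate between opponent and player moves and the
first one, if any, is an opponent move (`opp m = true`). -/
def Alternates {M : Type} (opp : M → Bool) : Bool → List M → Prop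
  | _, [] => True
  | b, m :: s => opp m = b ∧ Alternates opp (!b) s

theorem Alternates.prefix {M : Type} {opp : M → Bool} :
    ∀ {b : Bool} {s t : List M}, Alternates opp b (s ++ t) → Alternates opp b s
  | _, [], _, _ => trivial
  | _, _ :: _, _, h => ⟨h.1, Alternates.prefix h.2⟩

/-- Length of a play, its moves being encoded by `enc` and each followed by an end marker. -/
def playLength {M : Type} (enc : M → List Sym) (s : List M) : ℕ :=
  (s.map fun m => (enc m).length + 1).sum

/-- A parametrized game. `isOpp m = true` for opponent moves, `false` for player moves. -/
structure Game where
  Move : Type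
  isOpp : Move → Bool
  enc : Move → List Sym
  enc_injective : Function.Injective enc
  legal : ℕ → Set (List Move)
  nonempty : ∀ n, (legal n).Nonempty
  prefix_closed : ∀ n s t, s ++ t ∈ legal n → s ∈ legal n
  alternates : ∀ n, ∀ s ∈ legal n, Alternates isOpp true s
  bounded : ∃ P : Polynomial ℕ, ∀ n, ∀ s ∈ legal n, playLength enc s ≤ P.eval n

theorem Game.nil_legal (G : Game) (n : ℕ) : [] ∈ G.legal n := by
  obtain ⟨s, hs⟩ := G.nonempty n
  exact G.prefix_closed n [] s hs

/-- Encoding of the pair `(1 ^ n, s)`; `none` is the end marker. -/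
def Game.encInput (G : Game) (n : ℕ) (s : List G.Move) : List (Option Sym) :=
  List.replicate n (some Sym.tick) ++
    none :: s.flatMap (fun m => (G.enc m).map some ++ [none])

/-- Encoding of the moves of a ground game: `none` is the question `?`, `some a` the answer `a`. -/
def groundEnc {α : Type} (e : α → List Sym) : Option α → List Sym
  | none => [Sym.ask]
  | some a => Sym.ans :: e a

theorem groundEnc_injective {α : Type} {e : α → List Sym} (he : Function.Injective e) :
    Function.Injective (groundEnc e) := by
  intro x y h
  cases x <;> cases y <;> simp [groundEnc] at h ⊢
  exact he h

/-- Ground games: the opponent asks `?`, the player answers by some `a ∈ A n`. -/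
abbrev ground (α : Type) (e : α → List Sym) (he : Function.Injective e) (A : ℕ → Set α)
    (hA : ∃ P : Polynomial ℕ, ∀ n, ∀ a ∈ A n, (e a).length ≤ P.eval n) : Game where
  Move := Option α
  isOpp m := m.isNone
  enc := groundEnc e
  enc_injective := groundEnc_injective he
  legal n := {[], [none]} ∪ {s | ∃ a ∈ A n, s = [none, some a]}
  nonempty n := ⟨[], by simp⟩
  prefix_closed := by
    intro n s t h
    rcases s with _ | ⟨x, _ | ⟨y, _ | ⟨z, s⟩⟩⟩ <;>
      simp at h ⊢
    · rcases h with h | ⟨a, _, h⟩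
      · exact h.1
      · exact h.1
    · obtain ⟨a, ha, h⟩ := h
      exact ⟨a, ha, h.1, h.2.1⟩
  alternates := by
    rintro n s ((rfl | rfl) | ⟨a, _, rfl⟩) <;> simp [Alternates]
  bounded := by
    obtain ⟨P, hP⟩ := hA
    refine ⟨P + 4, fun n s hs => ?_⟩
    rcases hs with (rfl | rfl) | ⟨a, ha, rfl⟩
    · simp [playLength]
    · simp [playLength, groundEnc]
    · have := hP n a ha
      simp [playLength, groundEnc]
      omega

/-- The boolean game `B`. -/
abbrev boolGame : Game :=
  ground Bool (fun b => [Sym.bit b]) (fun a b h => by simpa using h) (fun _ => Set.univ)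
    ⟨1, fun n a _ => by simp⟩

/-- The game `S[p]` of strings of length `p n`. -/
abbrev strGame (p : Pol) : Game :=
  ground (List Bool) (fun w => w.map Sym.bit)
    (List.map_injective_iff.2 fun a b h => by simpa using h)
    (fun n => {w | w.length = p n})
    (by
      obtain ⟨P, hP⟩ := p.bound
      exact ⟨P, fun n w hw => by
        have h : w.length = p n := hw
        simpa [h] using hP n⟩)

/-- Symbols of the ternary alphabet `{0, 1, ⊥}`, where `none` is `⊥`. -/
def ternarySym : Option Bool → Sym
  | none => Sym.bot
  | some b => Sym.bit b

theorem ternarySym_injective : Function.Injective ternarySym := by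
  intro x y h
  cases x <;> cases y <;> simp [ternarySym] at h ⊢
  exact h

/-- The game of strings of length `p n` over the alphabet `{0, 1, ⊥}`. -/
abbrev ternaryGame (p : Pol) : Game :=
  ground (List (Option Bool)) (fun w => w.map ternarySym)
    (List.map_injective_iff.2 ternarySym_injective)
    (fun n => {w | w.length = p n})
    (by
      obtain ⟨P, hP⟩ := p.bound
      exact ⟨P, fun n w hw => by
        have h : w.length = p n := hw
        simpa [h] using hP n⟩)

theorem alternates_length_le (s : List (Option Bool)) :
    (Alternates Option.isNone true s → s.length ≤ 2 * s.count none) ∧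
    (Alternates Option.isNone false s → s.length ≤ 2 * s.count none + 1) := by
  induction s with
  | nil => simp
  | cons x s ih =>
    cases x
    · refine ⟨fun h => ?_, fun h => ?_⟩
      · have := ih.2 h.2
        simp
        omega
      · simp [Alternates] at h
    · refine ⟨fun h => ?_, fun h => ?_⟩
      · simp [Alternates] at h
      · have := ih.1 h.2
        simp
        omega

/-- The oracle game `O[p]`: at most `p n` times, the opponent asks `?` (`none`) and
the player answers by a bit. -/
abbrev oracle (p : Pol) : Game where
  Move := Option Bool
  isOpp m := m.isNone
  enc := groundEnc fun b => [Sym.bit b]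
  enc_injective := groundEnc_injective fun a b h => by simpa using h
  legal n := {s | Alternates Option.isNone true s ∧ s.count none ≤ p n}
  nonempty n := ⟨[], by simp [Alternates]⟩
  prefix_closed := by
    rintro n s t ⟨h₁, h₂⟩
    refine ⟨h₁.prefix, ?_⟩
    rw [List.count_append] at h₂
    omega
  alternates _ _ h := h.1
  bounded := by
    obtain ⟨P, hP⟩ := p.bound
    refine ⟨6 * P, fun n s hs => ?_⟩
    have h₁ := (alternates_length_le s).1 hs.1
    have h₂ : playLength (groundEnc fun b => [Sym.bit b]) s ≤ s.length * 3 := by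
      have := List.sum_le_card_nsmul
        (s.map fun m => (groundEnc (fun b => [Sym.bit b]) m).length + 1) 3 (by
          intro x hx
          obtain ⟨m, _, rfl⟩ := List.mem_map.1 hx
          cases m <;> simp [groundEnc])
      simpa [playLength] using this
    have h₃ := hP n
    have h₄ : s.count none ≤ p n := hs.2
    simp
    omega

/-! ### Linear function space -/

/-- Projections of a sequence of moves to the two components. -/
def restrictLeft {M N : Type} (s : List (M ⊕ N)) : List M := s.filterMap Sum.getLeft?

def restrictRight {M N : Type} (s : List (M ⊕ N)) : List N := s.filterMap Sum.getRight?

def lolliEnc {M N : Type} (e : M → List Sym) (e' : N → List Sym) : M ⊕ N → List Sym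
  | Sum.inl m => Sym.left :: e m
  | Sum.inr m => Sym.right :: e' m

theorem playLength_lolli {M N : Type} (e : M → List Sym) (e' : N → List Sym)
    (s : List (M ⊕ N)) :
    playLength (lolliEnc e e') s ≤
      2 * (playLength e (restrictLeft s) + playLength e' (restrictRight s)) := by
  induction s with
  | nil => simp [playLength]
  | cons x s ih =>
    cases x <;>
      simp [playLength, restrictLeft, restrictRight, lolliEnc, List.filterMap_cons] at ih ⊢ <;> omega

/-- The game `G ⊸ H`: the two players are exchanged in `G`. -/
abbrev lolli (G H : Game) : Game where
  Move := G.Move ⊕ H.Move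
  isOpp := Sum.elim (fun m => !G.isOpp m) H.isOpp
  enc := lolliEnc G.enc H.enc
  enc_injective := by
    rintro (x | x) (y | y) h <;> simp [lolliEnc] at h ⊢
    · exact G.enc_injective h
    · exact H.enc_injective h
  legal n := {s | Alternates (Sum.elim (fun m => !G.isOpp m) H.isOpp) true s ∧
    restrictLeft s ∈ G.legal n ∧ restrictRight s ∈ H.legal n}
  nonempty n := ⟨[], trivial, G.nil_legal n, H.nil_legal n⟩
  prefix_closed := by
    rintro n s t ⟨h₁, h₂, h₃⟩
    refine ⟨h₁.prefix, ?_, ?_⟩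
    · exact G.prefix_closed n _ (restrictLeft t) (by simpa [restrictLeft] using h₂)
    · exact H.prefix_closed n _ (restrictRight t) (by simpa [restrictRight] using h₃)
  alternates _ _ h := h.1
  bounded := by
    obtain ⟨P, hP⟩ := G.bounded
    obtain ⟨Q, hQ⟩ := H.bounded
    refine ⟨2 * (P + Q), fun n s hs => ?_⟩
    have h₁ := hP n _ hs.2.1
    have h₂ := hQ n _ hs.2.2
    have h₃ := playLength_lolli G.enc H.enc s
    simp
    omega

/-! ### Bounded exponentials -/

/-- The `i`-th projection of a sequence of moves with thread numbers. -/
def thread {M : Type} (i : ℕ) (s : List (ℕ × M)) : List M :=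
  s.filterMap fun m => if m.1 = i then some m.2 else none

def bangEnc {M : Type} (e : M → List Sym) (m : ℕ × M) : List Sym :=
  List.replicate m.1 Sym.tick ++ Sym.sep :: e m.2

theorem bangEnc_aux : ∀ (i j : ℕ) (l l' : List Sym),
    List.replicate i Sym.tick ++ Sym.sep :: l = List.replicate j Sym.tick ++ Sym.sep :: l' →
      i = j ∧ l = l'
  | 0, 0, l, l', h => by simpa using h
  | 0, j + 1, l, l', h => by simp [List.replicate_succ] at h
  | i + 1, 0, l, l', h => by simp [List.replicate_succ] at h
  | i + 1, j + 1, l, l', h => by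
    have := bangEnc_aux i j l l' (by simpa [List.replicate_succ] using h)
    exact ⟨by omega, this.2⟩

theorem playLength_bang {M : Type} (e : M → List Sym) (k : ℕ) (s : List (ℕ × M))
    (h : ∀ m ∈ s, m.1 < k) :
    playLength (bangEnc e) s ≤
      (k + 2) * ∑ i ∈ Finset.range k, playLength e (thread i s) := by
  induction s with
  | nil => simp [playLength]
  | cons x s ih =>
    have ih := ih fun m hm => h m (List.mem_cons_of_mem _ hm)
    have hx : x.1 < k := h x List.mem_cons_self
    have key : ∑ i ∈ Finset.range k, playLength e (thread i (x :: s)) =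
        (e x.2).length + 1 + ∑ i ∈ Finset.range k, playLength e (thread i s) := by
      have : ∀ i, playLength e (thread i (x :: s)) =
          (if x.1 = i then (e x.2).length + 1 else 0) + playLength e (thread i s) := by
        intro i
        by_cases hi : x.1 = i <;> simp [thread, playLength, hi]
      simp_rw [this, Finset.sum_add_distrib]
      simp [hx]
    rw [key, mul_add]
    have h₁ : playLength (bangEnc e) (x :: s) =
        x.1 + (e x.2).length + 2 + playLength (bangEnc e) s := by
      simp [playLength, bangEnc]
      ring
    rw [h₁]
    nlinarith [Nat.zero_le (e x.2).length, Nat.zero_le k]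

/-- The bounded exponential `![p] G`: at most `p n` copies of `G`, numbered `0, …, p n - 1` and
opened in this order, are played. -/
abbrev bang (p : Pol) (G : Game) : Game where
  Move := ℕ × G.Move
  isOpp m := G.isOpp m.2
  enc := bangEnc G.enc
  enc_injective := by
    rintro ⟨i, x⟩ ⟨j, y⟩ h
    obtain ⟨h₁, h₂⟩ := bangEnc_aux _ _ _ _ h
    exact Prod.ext h₁ (G.enc_injective h₂)
  legal n := {s | Alternates (fun m : ℕ × G.Move => G.isOpp m.2) true s ∧
    (∀ i, thread i s ∈ G.legal n) ∧
    (∀ m ∈ s, m.1 < p n) ∧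
    (∀ u i z v, s = u ++ (i + 1, z) :: v → ∃ x, (i, x) ∈ u)}
  nonempty n := ⟨[], trivial, fun _ => G.nil_legal n, by simp, by simp⟩
  prefix_closed := by
    rintro n s t ⟨h₁, h₂, h₃, h₄⟩
    refine ⟨h₁.prefix, fun i => ?_, fun m hm => h₃ m (List.mem_append_left _ hm), ?_⟩
    · exact G.prefix_closed n _ (thread i t) (by simpa [thread] using h₂ i)
    · rintro u i z v rfl
      exact h₄ u i z (v ++ t) (by simp)
  alternates _ _ h := h.1
  bounded := by
    obtain ⟨P, hP⟩ := p.bound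
    obtain ⟨Q, hQ⟩ := G.bounded
    refine ⟨(P + 2) * (P * Q), fun n s hs => ?_⟩
    refine (playLength_bang G.enc (p n) s hs.2.2.1).trans ?_
    have h₁ : ∑ i ∈ Finset.range (p n), playLength G.enc (thread i s) ≤ p n * Q.eval n := by
      simpa using Finset.sum_le_card_nsmul (Finset.range (p n)) _ (Q.eval n)
        fun i _ => hQ n _ (hs.2.1 i)
    have h₂ := hP n
    simp only [Polynomial.eval_mul, Polynomial.eval_add, Polynomial.eval_ofNat]
    gcongr
    exact h₁.trans (by gcongr)

/-! ### Strategies -/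

/-- The plays characterizing a family of partial functions: `ε` and all `s f(s)`. -/
def playsOf {M : Type} (next : ℕ → List M → Option M) (n : ℕ) : Set (List M) :=
  {[]} ∪ {u | ∃ s x, next n s = some x ∧ u = s ++ [x]}

/-- A (deterministic, total) strategy: `next n` is a partial function from the legal plays of odd
length to player moves. -/
structure Strategy (G : Game) where
  next : ℕ → List G.Move → Option G.Move
  domain : ∀ n s, (next n s).isSome → s ∈ G.legal n ∧ Odd s.length
  legal : ∀ n s x, next n s = some x → s ++ [x] ∈ G.legal n
  deterministic : ∀ n s x y, (next n (s ++ [x, y])).isSome → next n s = some x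
  total : ∀ n s x, s ∈ playsOf next n → s ++ [x] ∈ G.legal n → (next n (s ++ [x])).isSome

def Strategy.plays {G : Game} (f : Strategy G) (n : ℕ) : Set (List G.Move) := playsOf f.next n

/-- A Turing machine computes, in polynomial time, `f_n(s)` from `(1 ^ n, s)`, for `s` in the
domain of the partial function `f_n`. -/
def Strategy.PolytimeComputable {G : Game} (f : Strategy G) : Prop :=
  Nonempty (Turing.TM2ComputableInPolyTime
    (fun x : {x : ℕ × List G.Move // (f.next x.1 x.2).isSome} => G.encInput x.1.1 x.1.2)
    G.enc
    (fun x => (f.next x.1.1 x.1.2).get x.2))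

/-- The plays of `![p] f`, where all `p n` copies are played following the strategy with set of
plays `σ`. -/
def bangPlays (p : Pol) (G : Game) (n : ℕ) (σ : Set (List G.Move)) :
    Set (List (bang p G).Move) :=
  {s | s ∈ (bang p G).legal n ∧ ∀ i, thread i s ∈ σ}

/-- Composition of a strategy on `G`, with set of plays `σ`, and a strategy on `E ⊸ (G ⊸ H)`, with
set of plays `τ`: the plays of the resulting strategy on `E ⊸ H` are obtained by hiding
the moves of `G` from the interaction sequences. -/
def compPlays (E G H : Game) (σ : Set (List G.Move))
    (τ : Set (List (lolli E (lolli G H)).Move)) : Set (List (lolli E H).Move) :=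
  {s | ∃ u ∈ τ, restrictLeft (restrictRight u) ∈ σ ∧
    s = u.filterMap (Sum.elim (fun e => some (Sum.inl e))
      (Sum.elim (fun _ => none) (fun h => some (Sum.inr h))))}

/-- The play `? · ? b₁ ⋯ ? b_k · a` of `O[r] ⊸ H`, with `H` the ground game of ternary strings. -/
def observation (r t : Pol) (b : List Bool) (a : List (Option Bool)) :
    List (lolli (oracle r) (ternaryGame t)).Move :=
  Sum.inr (none : Option (List (Option Bool))) ::
    (b.flatMap fun c => [Sum.inl (none : Option Bool), Sum.inl (some c)]) ++
    [Sum.inr (some a)]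

open scoped Classical in
/-- Probability of observing the answer `a` when executing a probabilistic strategy on
`O[r] ⊸ H`, with `H` the ground game of ternary strings, whose plays at `n` are `τ`: the sum of
`2 ^ (-k)` over all `b₁ … b_k` that lead to `a`; no legal play has `k > r n`. -/
def probObserve (r t : Pol) (n : ℕ) (τ : Set (List (lolli (oracle r) (ternaryGame t)).Move))
    (a : List (Option Bool)) : ℝ :=
  ∑ k ∈ Finset.range (r n + 1), ∑ b : Fin k → Bool,
    if observation r t (List.ofFn b) a ∈ τ then (1 / 2 : ℝ) ^ k else 0

/-! ### Second-order functions as strategies -/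

/-- The game `S[ι] ⊸ B` of predicates on strings of length `n`. -/
abbrev predGame : Game := lolli (strGame Pol.iota) boolGame

/-- The game `![q] (S[ι] ⊸ B) ⊸ S[p]`. -/
abbrev sofGame (q p : Pol) : Game := lolli (bang q predGame) (strGame p)

/-- The plays of the strategy on `S[ι] ⊸ B` that asks for its argument `w` and answers `φ w`. -/
def predPlays {n : ℕ} (φ : List.Vector Bool n → Bool) : Set (List predGame.Move) :=
  {[], [Sum.inr (none : Option Bool), Sum.inl (none : Option (List Bool))]} ∪
  {s | ∃ w : List.Vector Bool n, s =
    [Sum.inr (none : Option Bool), Sum.inl (none : Option (List Bool)),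
      Sum.inl (some w.toList), Sum.inr (some (φ w))]}

/-- `f` computes `F`: playing `f` against (copies of) the strategy of `φ` leads to the answer
`F n φ`. -/
def Strategy.Computes {q p : Pol} (f : Strategy (sofGame q p))
    (F : ∀ n, (List.Vector Bool n → Bool) → List.Vector Bool (p n)) : Prop :=
  ∀ n φ, ∃ s ∈ f.plays n,
    restrictLeft s ∈ bangPlays q predGame n (predPlays φ) ∧
    restrictRight s = [(none : Option (List Bool)), some (F n φ).toList]

/-! ### Distributions and variance -/

/-- The number of coordinates fixed by a partial function `g : [N] ⇀ {0, 1}`. -/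
def domCard {N : ℕ} (g : Fin N → Option Bool) : ℕ :=
  (Finset.univ.filter fun j => (g j).isSome).card

open scoped Classical in
/-- The uniform distribution on the strings of length `N` that agree with `g`. -/
def semiUniform {N : ℕ} (g : Fin N → Option Bool) (x : Fin N → Bool) : ℝ :=
  if ∀ j b, g j = some b → x j = b then 1 / 2 ^ (N - domCard g) else 0

open scoped Classical in
/-- The image of the distribution `D` under `h`. -/
def pushforward {α β : Type} [Fintype α] (h : α → β) (D : α → ℝ) (y : β) : ℝ :=
  ∑ x, if h x = y then D x else 0

open scoped Classical in
/-- The variance `Pr[F x ≠ F y]` of `F`, for `x` and `y` drawn independently from `D`. -/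
def variance {α β : Type} [Fintype α] (D : α → ℝ) (F : α → β) : ℝ :=
  ∑ x, ∑ y, if F x ≠ F y then D x * D y else 0

/-- The number with binary expansion `w`, most significant bit first. -/
def binVal (w : List Bool) : ℕ := w.foldl (fun a b => 2 * a + b.toNat) 0

theorem binVal_lt (w : List Bool) : binVal w < 2 ^ w.length := by
  induction w using List.reverseRecOn with
  | nil => simp [binVal]
  | append_singleton w b ih =>
    have h : binVal (w ++ [b]) = 2 * binVal w + b.toNat := by simp [binVal]
    have hb := b.toNat_le
    rw [h, List.length_append, List.length_singleton, pow_succ]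
    omega

theorem block_lt {n N : ℕ} (hN : N ∣ 2 ^ n) (w : List.Vector Bool n) :
    binVal w.toList / (2 ^ n / N) < N := by
  have h := binVal_lt w.toList
  rw [List.Vector.toList_length] at h
  apply Nat.div_lt_of_lt_mul
  rwa [Nat.div_mul_cancel hN]

/-- The extension of a string `x` of length `N`: the `2 ^ n` inputs are divided into `N` consecutive
blocks of equal size, and the value on the `j`-th block is `x j`. -/
def extension {n N : ℕ} (hN : N ∣ 2 ^ n) (x : Fin N → Bool) (w : List.Vector Bool n) : Bool :=
  x ⟨binVal w.toList / (2 ^ n / N), block_lt hN w⟩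

end

end ParamGames

/-!
The value of a second-order function is certified by a single run. If `f` is run on the constantly
false predicate until it answers, the run queries the predicate at no more than `q n` arguments, at
most one in each thread (`length_queries_le`). On any other predicate that is false at these
arguments the same sequence of moves is again a run of `f`, and since `f` is deterministic and the
opponent of a second-order function has no freedom, the value is the same
(`Strategy.Computes.eq_of_queries`). Let `g` be `false` on the blocks that contain a queried
argument and undefined elsewhere. Every predicate in the support of the distribution given by `g` is
false at the queried arguments, so the function is constant there and its variance is zero
(`variance_markFun`), while the domain of `g` has at most `q n` elements. This is below
`p n * q n ^ 2 / (δ * ε)` as soon as `1 ≤ p n`, `ε ≤ 1` and `δ < 1`. If `p n = 0` the function is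
constant anyway, and if `ε > 1` the variance is no constraint, so the nowhere defined `g` will do; if
`δ ≥ 1` there is nothing to show. Hence `C = 1` suffices, and the strategy `infvar` needs neither
oracle bits nor a second copy of `f`.

That the opponent has no freedom is a consequence of the switching condition: by parity only the
player of a second-order function can change between its threads (`bang_switching`), so every
opponent move is the reply to the move just before it (`follows_of_predPlays`), and two runs on the
same predicate are comparable (`plays_prefix`).

The strategy is computed by a machine (`program`) that first runs the given machine for `t`, to lay
out `t n` empty cells, and then reads the history once. For each argument it finds the block by
repeated halving (`blockIdx`), which is correct because `t n`, as a divisor of `2 ^ n`, is a power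
of two, and marks the cell. At the end it writes the reply to the last move, or the cells if `f` has
answered (`reach_run`, `infvar_polytimeComputable`).
-/

namespace ParamGames

noncomputable section

/-! ### Alternation, threads and switching -/

theorem alternates_append_singleton {M : Type} {opp : M → Bool} (x : M) :
    ∀ (b : Bool) (s : List M),
      Alternates opp b (s ++ [x]) ↔ Alternates opp b s ∧ (Even s.length ↔ opp x = b)
  | b, [] => by simp [Alternates]
  | b, y :: s => by
    have ih := alternates_append_singleton (opp := opp) x (!b) s
    simp only [List.cons_append, Alternates, ih, List.length_cons, Nat.even_add_one, and_assoc]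
    cases b <;> cases opp x <;> simp

theorem Alternates.append_reply {M : Type} {opp : M → Bool} {b : Bool} {s : List M} {x y : M}
    (h : Alternates opp b (s ++ [x])) (hy : opp y = !opp x) :
    Alternates opp b (s ++ [x, y]) := by
  have h' := (alternates_append_singleton x b s).1 h
  have : s ++ [x, y] = s ++ [x] ++ [y] := by simp
  rw [this, alternates_append_singleton]
  refine ⟨h, ?_⟩
  simp only [List.length_append, List.length_singleton, Nat.even_add_one, h'.2, hy]
  cases b <;> cases opp x <;> simp

theorem alternates_map {M N : Type} {opp : M → Bool} {opp' : N → Bool} {c : Bool} (h : M → N)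
    (hh : ∀ m, opp' (h m) = (c ^^ opp m)) :
    ∀ (b : Bool) (s : List M), Alternates opp b s → Alternates opp' (c ^^ b) (s.map h)
  | _, [], _ => trivial
  | b, m :: s, hs => by
    refine ⟨by rw [hh, hs.1], ?_⟩
    have := alternates_map h hh (!b) s hs.2
    simpa using this

section thread

variable {M : Type}

@[simp] theorem thread_nil (i : ℕ) : thread i ([] : List (ℕ × M)) = [] := rfl

@[simp] theorem thread_append (i : ℕ) (s t : List (ℕ × M)) :
    thread i (s ++ t) = thread i s ++ thread i t := by
  simp [thread]

@[simp] theorem thread_cons_self (i : ℕ) (x : M) (s : List (ℕ × M)) :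
    thread i ((i, x) :: s) = x :: thread i s := by
  simp [thread]

theorem thread_cons_of_ne {i j : ℕ} (h : j ≠ i) (x : M) (s : List (ℕ × M)) :
    thread i ((j, x) :: s) = thread i s := by
  simp [thread, h]

theorem thread_zero_map (s : List M) : thread 0 (s.map fun m => (0, m)) = s := by
  induction s with
  | nil => rfl
  | cons x s ih => simp [ih]

theorem thread_succ_map (i : ℕ) (s : List M) : thread (i + 1) (s.map fun m => (0, m)) = [] := by
  induction s with
  | nil => rfl
  | cons x s ih => simp [thread_cons_of_ne, ih]

/-- The switching condition in interleavings: threads are at rest (of even length) except, at odd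
length, the thread of the last move. -/
theorem thread_parity {opp : M → Bool} (s : List (ℕ × M)) :
    Alternates (fun m : ℕ × M => opp m.2) true s → (∀ i, Alternates opp true (thread i s)) →
    (Even s.length → ∀ i, Even (thread i s).length) ∧
      ∀ u j z, s = u ++ [(j, z)] → Odd s.length → ∀ i, i ≠ j → Even (thread i s).length := by
  induction s using List.reverseRecOn with
  | nil => intro _ _; simp
  | append_singleton s x ih =>
    intro h₁ h₂
    obtain ⟨j, z⟩ := x
    have h₁' := (alternates_append_singleton _ _ _).1 h₁
    have h₂' : ∀ i, Alternates opp true (thread i s) := fun i =>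
      Alternates.prefix (t := thread i [(j, z)]) (by rw [← thread_append]; exact h₂ i)
    obtain ⟨ih₁, ih₂⟩ := ih h₁'.1 h₂'
    have hj := h₂ j
    simp only [thread_append, thread_cons_self, thread_nil] at hj
    have hj' := ((alternates_append_singleton _ _ _).1 hj).2
    refine ⟨fun he i => ?_, ?_⟩
    · have ho : ¬ Even s.length := by simpa [Nat.even_add_one] using he
      have hz : ¬ Even (thread j s).length := by
        rw [hj', ← h₁'.2]
        exact ho
      by_cases hi : i = j
      · subst hi
        simp [Nat.even_add_one, hz]
      · rcases List.eq_nil_or_concat s with rfl | ⟨s', ⟨j', z'⟩, rfl⟩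
        · simp at ho
        · have h := ih₂ s' j' z' (by simp) (by simpa using ho)
          have hjj : j = j' := by
            by_contra hne
            exact hz (h j hne)
          rw [thread_append, thread_cons_of_ne (Ne.symm hi), thread_nil, List.append_nil]
          exact h i (hjj ▸ hi)
    · intro u j' z' hu ho i hi
      obtain ⟨rfl, hu'⟩ := List.append_inj' hu rfl
      simp only [List.cons.injEq, Prod.mk.injEq, and_true] at hu'
      rw [thread_append, thread_cons_of_ne (by rw [hu'.1]; exact Ne.symm hi), thread_nil,
        List.append_nil]
      refine ih₁ ?_ i
      simpa [Nat.even_add_one, parity_simps] using ho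

end thread

/-- In `![p] G`, the player stays in the thread of the preceding opponent move. -/
theorem bang_switching {p : Pol} {G : Game} {n : ℕ} {s : List (ℕ × G.Move)} {i j : ℕ}
    {x y : G.Move} (h : s ++ [(i, x), (j, y)] ∈ (bang p G).legal n) (hy : G.isOpp y = false) :
    j = i := by
  obtain ⟨h₁, h₂, -, -⟩ := h
  have e : s ++ [(i, x), (j, y)] = s ++ [(i, x)] ++ [(j, y)] := by simp
  rw [e] at h₁ h₂
  by_contra hne
  have h₁' := (alternates_append_singleton _ _ _).1 h₁
  have ha : ∀ k, Alternates G.isOpp true (thread k (s ++ [(i, x)])) := fun k =>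
    Alternates.prefix (t := thread k [(j, y)])
      (by rw [← thread_append]; exact G.alternates n _ (h₂ k))
  have ho : Odd (s ++ [(i, x)]).length := by
    rw [← Nat.not_even_iff_odd, h₁'.2]
    simp [hy]
  have he := (thread_parity _ h₁'.1 ha).2 s i x rfl ho j hne
  have hj := G.alternates n _ (h₂ j)
  rw [thread_append, thread_cons_self, thread_nil, alternates_append_singleton] at hj
  rw [hj.2.1 he] at hy
  exact absurd hy (by simp)

/-- An answering move in the thread of the preceding move opens no thread. -/
theorem bang_append_reply {p : Pol} {G : Game} {n : ℕ} {s : List (ℕ × G.Move)} {j : ℕ}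
    {x y : G.Move} (h : s ++ [(j, x)] ∈ (bang p G).legal n) (hy : G.isOpp y = !G.isOpp x)
    (hl : thread j s ++ [x, y] ∈ G.legal n) :
    s ++ [(j, x), (j, y)] ∈ (bang p G).legal n := by
  obtain ⟨h₁, h₂, h₃, h₄⟩ := h
  have e : s ++ [(j, x), (j, y)] = s ++ [(j, x)] ++ [(j, y)] := by simp
  refine ⟨h₁.append_reply hy, fun i => ?_, fun m hm => ?_, ?_⟩
  · by_cases hi : j = i
    · subst hi
      simpa using hl
    · have := h₂ i
      rw [thread_append, thread_cons_of_ne hi] at this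
      rwa [thread_append, thread_cons_of_ne hi, thread_cons_of_ne hi]
  · rw [e, List.mem_append] at hm
    rcases hm with hm | hm
    · exact h₃ m hm
    · rw [List.mem_singleton.1 hm]
      exact h₃ (j, x) (by simp)
  · intro u i z v huv
    rcases List.eq_nil_or_concat v with rfl | ⟨v, w, rfl⟩
    · rw [e] at huv
      obtain ⟨rfl, hu⟩ := List.append_inj' huv rfl
      simp only [List.cons.injEq, Prod.mk.injEq, and_true] at hu
      obtain ⟨x', hx'⟩ := h₄ s i x [] (by rw [hu.1])
      exact ⟨x', List.mem_append_left _ hx'⟩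
    · rw [e] at huv
      have huv' : s ++ [(j, x)] ++ [(j, y)] = (u ++ (i + 1, z) :: v) ++ [w] := by simpa using huv
      exact h₄ u i z v (List.append_inj' huv' rfl).1

theorem mem_boolGame_legal {n : ℕ} {s : List (Option Bool)} :
    s ∈ boolGame.legal n ↔ s = [] ∨ s = [none] ∨ ∃ b, s = [none, some b] := by
  simp [or_assoc]

theorem mem_strGame_legal {p : Pol} {n : ℕ} {s : List (Option (List Bool))} :
    s ∈ (strGame p).legal n ↔ s = [] ∨ s = [none] ∨ ∃ a, a.length = p n ∧ s = [none, some a] := by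
  simp [or_assoc]

theorem mem_ternaryGame_legal {t : Pol} {n : ℕ} {s : List (Option (List (Option Bool)))} :
    s ∈ (ternaryGame t).legal n ↔
      s = [] ∨ s = [none] ∨ ∃ a, a.length = t n ∧ s = [none, some a] := by
  simp [or_assoc]

theorem boolGame_question {n : ℕ} {s : List (Option Bool)} (h : s ++ [none] ∈ boolGame.legal n) :
    s = [] := by
  rw [mem_boolGame_legal] at h
  rcases h with h | h | ⟨b, h⟩
  · simp at h
  · simpa using h
  · have := congrArg List.getLast? h
    simp at this

/-! ### Projections -/

section restrict

variable {M N : Type}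

@[simp] theorem restrictLeft_nil : restrictLeft ([] : List (M ⊕ N)) = [] := rfl
@[simp] theorem restrictRight_nil : restrictRight ([] : List (M ⊕ N)) = [] := rfl
@[simp] theorem restrictLeft_inl (x : M) (s : List (M ⊕ N)) :
    restrictLeft (Sum.inl x :: s) = x :: restrictLeft s := rfl
@[simp] theorem restrictLeft_inr (x : N) (s : List (M ⊕ N)) :
    restrictLeft (Sum.inr x :: s) = restrictLeft s := rfl
@[simp] theorem restrictRight_inl (x : M) (s : List (M ⊕ N)) :
    restrictRight (Sum.inl x :: s) = restrictRight s := rfl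
@[simp] theorem restrictRight_inr (x : N) (s : List (M ⊕ N)) :
    restrictRight (Sum.inr x :: s) = x :: restrictRight s := rfl
@[simp] theorem restrictLeft_append (s t : List (M ⊕ N)) :
    restrictLeft (s ++ t) = restrictLeft s ++ restrictLeft t := by simp [restrictLeft]
@[simp] theorem restrictRight_append (s t : List (M ⊕ N)) :
    restrictRight (s ++ t) = restrictRight s ++ restrictRight t := by simp [restrictRight]

theorem restrict_length (s : List (M ⊕ N)) :
    s.length = (restrictLeft s).length + (restrictRight s).length := by
  induction s with
  | nil => rfl
  | cons x s ih => cases x <;> simp [ih] <;> omega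

end restrict

/-! ### Plays on predicates -/

/-- Moves of the game of predicates on strings. -/
abbrev PredMove : Type := Option (List Bool) ⊕ Option Bool

theorem predGame_question {n : ℕ} {s : List PredMove}
    (h : s ++ [Sum.inr none] ∈ predGame.legal n) : s = [] := by
  obtain ⟨h₁, h₂, h₃⟩ := h
  rw [restrictRight_append] at h₃
  have h₃' := boolGame_question h₃
  rcases s with _ | ⟨x, s⟩
  · rfl
  · rcases x with (_ | x) | x
    · simp [Alternates] at h₁
    · rw [mem_strGame_legal] at h₂
      simp at h₂
    · simp at h₃'

theorem predGame_argument {n : ℕ} {s : List PredMove} {w : List Bool}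
    (h : s ++ [Sum.inl (some w)] ∈ predGame.legal n) :
    s = [Sum.inr none, Sum.inl none] ∧ w.length = n := by
  obtain ⟨h₁, h₂, h₃⟩ := h
  rw [mem_strGame_legal] at h₂
  rw [mem_boolGame_legal] at h₃
  have hw : w.length = n ∧ restrictLeft s = [none] := by
    rcases h₂ with h | h | ⟨a, ha, h⟩
    · simp at h
    · have := congrArg List.getLast? h
      simp at this
    · have e : restrictLeft s ++ [some w] = [none] ++ [some a] := by simpa using h
      obtain ⟨h, h'⟩ := List.append_inj' e rfl
      simp only [List.cons.injEq, Option.some.injEq, and_true] at h'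
      exact ⟨h' ▸ ha, h⟩
  refine ⟨?_, hw.1⟩
  replace hw := hw.2
  clear h₂
  rcases s with _ | ⟨x, s⟩
  · simp at hw
  · rcases x with (_ | x) | (_ | x)
    · simp [Alternates] at h₁
    · simp at hw
    · rcases s with _ | ⟨y, s⟩
      · simp at hw
      · rcases y with (_ | y) | (_ | y)
        · rcases s with _ | ⟨z, s⟩
          · rfl
          · rcases z with (_ | z) | (_ | z)
            · simp at hw
            · simp at hw
            · simp at h₃
            · simp [Alternates] at h₁
        · simp [Alternates] at h₁
        · simp at h₃
        · rcases s with _ | ⟨z, s⟩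
          · simp at hw
          · rcases z with (_ | z) | (_ | z)
            · simp [Alternates] at h₁
            · simp at hw
            · simp at h₃
            · simp at h₃
    · simp [Alternates] at h₁

/-! ### Answering the moves of a second-order function -/

/-- Moves of the games of second-order functions. -/
abbrev SofMove : Type := (ℕ × PredMove) ⊕ Option (List Bool)

/-- The reply of the strategies of the predicate `φ` to a move of a second-order function; there is
none if that move is the final answer. -/
def replyTo (φ : List Bool → Bool) : SofMove → Option SofMove
  | Sum.inl (j, Sum.inr none) => some (Sum.inl (j, Sum.inl none))
  | Sum.inl (j, Sum.inl (some w)) => some (Sum.inl (j, Sum.inr (some (φ w))))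
  | _ => none

/-- The opponent's next move in a play of even length of a second-order function that is applied
to `φ`. -/
def sofReply (φ : List Bool → Bool) (v : List SofMove) : Option SofMove :=
  match v.getLast? with
  | none => some (Sum.inr none)
  | some m => replyTo φ m

/-- All opponent moves in a play of a second-order function are those made on behalf of `φ`. -/
def Follows (φ : List Bool → Bool) (v : List SofMove) : Prop :=
  ∀ u x w, v = u ++ x :: w → Even u.length → sofReply φ u = some x

@[simp] theorem sofReply_nil (φ : List Bool → Bool) : sofReply φ [] = some (Sum.inr none) := rfl

@[simp] theorem sofReply_append_singleton (φ : List Bool → Bool) (v : List SofMove)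
    (m : SofMove) : sofReply φ (v ++ [m]) = replyTo φ m := by
  simp [sofReply]

theorem Follows.nil (φ : List Bool → Bool) : Follows φ [] := by
  intro u x w h
  simp at h

theorem Follows.prefix {φ : List Bool → Bool} {u v : List SofMove} (h : Follows φ (u ++ v)) :
    Follows φ u := by
  intro u' x w hu he
  exact h u' x (w ++ v) (by simp [hu]) he

theorem Follows.append_round {φ : List Bool → Bool} {v : List SofMove} {x y : SofMove}
    (h : Follows φ v) (hv : Even v.length) (hx : sofReply φ v = some x) :
    Follows φ (v ++ [x, y]) := by
  intro u x' w hu he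
  rcases List.append_eq_append_iff.1 hu with ⟨a, ha, hb⟩ | ⟨c, hc, hd⟩
  · rcases a with _ | ⟨a₁, _ | ⟨a₂, a⟩⟩
    · simp only [List.append_nil] at ha
      simp only [List.nil_append, List.cons.injEq] at hb
      rw [ha, ← hb.1, hx]
    · simp [ha, Nat.even_add_one, hv] at he
    · simp at hb
  · rcases c with _ | ⟨c₁, c⟩
    · simp only [List.append_nil] at hc
      simp only [List.nil_append, List.cons.injEq] at hd
      rw [← hc, hd.1, hx]
    · simp only [List.cons_append, List.cons.injEq] at hd
      exact h u x' c (by rw [hc, hd.1]) he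

variable {q p : Pol} {n : ℕ}

theorem sof_reply_legal {φ : List Bool → Bool} {v : List SofMove} {x : SofMove}
    (h : v ∈ (sofGame q p).legal n) (hx : sofReply φ v = some x) :
    v ++ [x] ∈ (sofGame q p).legal n := by
  rcases List.eq_nil_or_concat v with rfl | ⟨v, m, rfl⟩
  · obtain rfl : Sum.inr none = x := by simpa using hx
    refine ⟨by simp [Alternates], (bang q predGame).nil_legal n, ?_⟩
    simp
  · rw [List.concat_eq_append] at h hx ⊢
    rw [sofReply_append_singleton] at hx
    rw [List.append_assoc]
    obtain ⟨h₁, h₂, h₃⟩ := h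
    rcases m with ⟨j, (_ | w) | (_ | b)⟩ | m <;> simp only [replyTo, Option.some.injEq,
      reduceCtorEq] at hx
    · subst hx
      rw [restrictLeft_append] at h₂
      have ht := h₂.2.1 j
      rw [restrictLeft_inl, restrictLeft_nil, thread_append, thread_cons_self, thread_nil] at ht
      obtain ⟨hs, hw⟩ := predGame_argument ht
      refine ⟨h₁.append_reply rfl, ?_, by simpa using h₃⟩
      rw [restrictLeft_append]
      refine bang_append_reply h₂ rfl ?_
      rw [hs]
      refine ⟨by simp [Alternates], ?_, ?_⟩
      · refine Or.inr ⟨w, hw, ?_⟩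
        simp
      · refine Or.inr ⟨φ w, trivial, ?_⟩
        simp
    · subst hx
      rw [restrictLeft_append] at h₂
      have ht := h₂.2.1 j
      rw [restrictLeft_inl, restrictLeft_nil, thread_append, thread_cons_self, thread_nil] at ht
      have hs := predGame_question ht
      refine ⟨h₁.append_reply rfl, ?_, by simpa using h₃⟩
      rw [restrictLeft_append]
      refine bang_append_reply h₂ rfl ?_
      rw [hs]
      refine ⟨by simp [Alternates], ?_, ?_⟩
      · exact Or.inl (by simp)
      · exact Or.inl (by simp)

/-- A play of even length that the opponent cannot continue ends with the final answer. -/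
theorem sof_answered {φ : List Bool → Bool} {v : List SofMove}
    (h : v ∈ (sofGame q p).legal n) (hv : Even v.length) (hx : sofReply φ v = none) :
    ∃ u a, v = u ++ [Sum.inr (some a)] ∧ restrictRight v = [none, some a] := by
  rcases List.eq_nil_or_concat v with rfl | ⟨v, m, rfl⟩
  · simp at hx
  · rw [List.concat_eq_append] at h hx hv ⊢
    rw [sofReply_append_singleton] at hx
    obtain ⟨h₁, -, h₃⟩ := h
    have hm := ((alternates_append_singleton _ _ _).1 h₁).2
    have ho : ¬ Even v.length := by simpa [Nat.even_add_one] using hv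
    rw [iff_false_left ho] at hm
    rw [mem_strGame_legal] at h₃
    rcases m with ⟨j, (_ | w) | (_ | b)⟩ | (_ | a)
    · simp at hm
    · simp [replyTo] at hx
    · simp [replyTo] at hx
    · simp at hm
    · simp at hm
    · refine ⟨v, a, rfl, ?_⟩
      rcases h₃ with h | h | ⟨a', -, h⟩
      · simp at h
      · have := congrArg List.getLast? h
        simp at this
      · have := congrArg List.getLast? h
        simp only [restrictRight_append, restrictRight_inr, restrictRight_nil] at this
        rw [h]
        simp at this
        rw [this]

end

end ParamGames

namespace ParamGames

noncomputable section

variable {q p t : Pol} {n : ℕ}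

/-! ### Marking the queried blocks -/

/-- A step in the computation of a block index. The state `(r, y)` means that the bits read so far
single out `r` consecutive blocks, the `y`-th group of that size; the next bit chooses a half of the
group. Once `r = 1` the remaining bits have no effect. -/
def blockStep (s : ℕ × ℕ) (b : Bool) : ℕ × ℕ :=
  if 2 ≤ s.1 then (s.1 / 2, 2 * s.2 + b.toNat) else s

/-- The `y`-th group of `r` blocks stays within the `N` blocks. -/
theorem blockStep_bound {N : ℕ} {s : ℕ × ℕ} (hs : (s.2 + 1) * s.1 ≤ N) (b : Bool) :
    ((blockStep s b).2 + 1) * (blockStep s b).1 ≤ N := by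
  obtain ⟨r, y⟩ := s
  simp only [blockStep] at hs ⊢
  split_ifs
  · have h : r / 2 * 2 ≤ r := Nat.div_mul_le_self r 2
    have hb : b.toNat ≤ 1 := b.toNat_le
    calc (2 * y + b.toNat + 1) * (r / 2) ≤ (2 * y + 2) * (r / 2) :=
          Nat.mul_le_mul_right _ (by omega)
      _ = (y + 1) * (r / 2 * 2) := by ring
      _ ≤ (y + 1) * r := by gcongr
      _ ≤ N := hs
  · exact hs

/-- The block of `w` among `N` blocks, computed by reading the bits of `w`, the most significant
one first. It is the index of the block that contains `w` if `N` divides `2 ^ w.length`. -/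
def blockIdx (N : ℕ) (w : List Bool) : ℕ :=
  (w.foldl blockStep (N, 0)).2

/-- The arguments at which a second-order function has queried its predicate. -/
def queries (v : List SofMove) : List (List Bool) :=
  v.filterMap fun
    | Sum.inl (_, Sum.inl (some w)) => some w
    | _ => none

/-- The partial function on `N` blocks that is `false` on the blocks of the given queries. -/
def markBlocks (N : ℕ) (ws : List (List Bool)) : List (Option Bool) :=
  ws.foldl (fun L w => L.set (blockIdx N w) (some false)) (List.replicate N none)

/-- The answer that ends a play of a second-order function. -/
def finalAnswer (v : List SofMove) : List Bool :=
  match v.getLast? with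
  | some (Sum.inr (some a)) => a
  | _ => []

/-- The partial function read off from a completed play: `false` on the queried blocks, undefined
elsewhere. It is nowhere defined if nothing is to be recorded or if the answer carries no
information. -/
def certificate (rec : Bool) (N : ℕ) (v : List SofMove) : List (Option Bool) :=
  if rec && !(finalAnswer v).isEmpty then markBlocks N (queries v) else List.replicate N none

theorem length_foldl_set {α β : Type} (f : β → ℕ) (a : α) (ws : List β) (L : List α) :
    (ws.foldl (fun L w => L.set (f w) a) L).length = L.length := by
  induction ws generalizing L with
  | nil => rfl
  | cons w ws ih => simp [ih]

@[simp] theorem length_certificate (rec : Bool) (N : ℕ) (v : List SofMove) :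
    (certificate rec N v).length = N := by
  unfold certificate markBlocks
  split
  · rw [length_foldl_set, List.length_replicate]
  · simp

/-! ### The strategy -/

/-- The game `O[0] ⊸ (![1] SOF ⊸ T[t])`, whose player uses no random bits and a single copy of the
second-order function. -/
abbrev infGame (q p t : Pol) : Game :=
  lolli (oracle (Pol.ofPolynomial 0))
    (lolli (bang (Pol.ofPolynomial 1) (sofGame q p)) (ternaryGame t))

/-- Moves of `infGame`. -/
abbrev InfMove : Type := Option Bool ⊕ ((ℕ × SofMove) ⊕ Option (List (Option Bool)))

/-- A move in the copy of the second-order function. -/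
def callMove (m : SofMove) : InfMove := Sum.inr (Sum.inl (0, m))

/-- The question that starts a play. -/
def openMove : InfMove := Sum.inr (Sum.inr none)

/-- The answer that ends a play. -/
def outMove (a : List (Option Bool)) : InfMove := Sum.inr (Sum.inr (some a))

/-- The initial question, followed by a play of the second-order function. -/
def wrap (v : List SofMove) : List InfMove := openMove :: v.map callMove

theorem callMove_injective : Function.Injective callMove := by
  intro x y h
  simpa [callMove] using h

theorem wrap_injective : Function.Injective wrap := by
  intro x y h
  exact callMove_injective.list_map (List.cons.inj h).2

@[simp] theorem wrap_append (v w : List SofMove) : wrap (v ++ w) = wrap v ++ w.map callMove := by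
  simp [wrap]

@[simp] theorem length_wrap (v : List SofMove) : (wrap v).length = v.length + 1 := by
  simp [wrap]

@[simp] theorem restrictLeft_map_callMove (v : List SofMove) :
    restrictLeft (v.map callMove) = [] := by
  induction v with
  | nil => rfl
  | cons x v ih => simpa [callMove] using ih

@[simp] theorem restrictRight_map_callMove (v : List SofMove) :
    restrictRight (v.map callMove) = v.map fun m => Sum.inl (0, m) := by
  induction v with
  | nil => rfl
  | cons x v ih => simpa [callMove] using ih

@[simp] theorem restrictLeft_map_inl {M N : Type} (v : List SofMove) (f : SofMove → M) :
    restrictLeft (v.map fun m => (Sum.inl (f m) : M ⊕ N)) = v.map f := by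
  induction v with
  | nil => rfl
  | cons x v ih => simpa using ih

@[simp] theorem restrictRight_map_inl {M N : Type} (v : List SofMove) (f : SofMove → M) :
    restrictRight (v.map fun m => (Sum.inl (f m) : M ⊕ N)) = [] := by
  induction v with
  | nil => rfl
  | cons x v ih => simpa using ih

theorem bang_legal_of_sof {v : List SofMove} (h : v ∈ (sofGame q p).legal n) :
    v.map (fun m => (0, m)) ∈ (bang (Pol.ofPolynomial 1) (sofGame q p)).legal n := by
  refine ⟨?_, fun i => ?_, ?_, ?_⟩
  · have := alternates_map (opp := (sofGame q p).isOpp)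
      (opp' := fun m : ℕ × (sofGame q p).Move => (sofGame q p).isOpp m.2) (c := false)
      (fun m => (0, m)) (fun m => by simp) true v h.1
    simpa using this
  · rcases i with _ | i
    · rw [thread_zero_map]
      exact h
    · rw [thread_succ_map]
      exact (sofGame q p).nil_legal n
  · intro m hm
    obtain ⟨m', -, rfl⟩ := List.mem_map.1 hm
    simp [Pol.ofPolynomial]
  · intro u i z w hv
    have : ((i + 1, z) : ℕ × SofMove) ∈ v.map (fun m => (0, m)) := by
      rw [hv]
      simp
    simp at this

theorem wrap_legal {v : List SofMove} (h : v ∈ (sofGame q p).legal n) :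
    wrap v ∈ (infGame q p t).legal n := by
  refine ⟨⟨rfl, ?_⟩, ?_, ?_, ?_, ?_⟩
  · exact alternates_map (opp := (sofGame q p).isOpp) (c := true) callMove
      (fun m => by simp [callMove]) true v h.1
  · simp [wrap, openMove, Alternates]
  · have := alternates_map (opp := (sofGame q p).isOpp)
      (opp' := (lolli (bang (Pol.ofPolynomial 1) (sofGame q p)) (ternaryGame t)).isOpp)
      (c := true) (fun m => Sum.inl (0, m))
      (fun m => by simp) true v h.1
    have e : restrictRight (wrap v) = Sum.inr none :: v.map fun m => Sum.inl (0, m) := by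
      simp [wrap, openMove]
    rw [e]
    exact ⟨rfl, this⟩
  · simpa [wrap, openMove] using bang_legal_of_sof h
  · rw [mem_ternaryGame_legal]
    simp [wrap, openMove]

theorem sof_legal_of_wrap {v : List SofMove} (h : wrap v ∈ (infGame q p t).legal n) :
    v ∈ (sofGame q p).legal n := by
  have := h.2.2.2.1.2.1 0
  simpa [wrap, openMove, thread_zero_map] using this

theorem outMove_legal {v : List SofMove} {a : List (Option Bool)}
    (h : v ∈ (sofGame q p).legal n) (hv : Even v.length) (ha : a.length = t n) :
    wrap v ++ [outMove a] ∈ (infGame q p t).legal n := by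
  obtain ⟨h₁, h₂, h₃, h₄, h₅⟩ := wrap_legal (t := t) h
  refine ⟨?_, ?_, ?_, ?_, ?_⟩
  · rw [alternates_append_singleton]
    refine ⟨h₁, ?_⟩
    simp [outMove, Nat.even_add_one, hv]
  · simpa [outMove] using h₂
  · rw [restrictRight_append]
    simp only [outMove, restrictRight_inr, restrictRight_nil]
    rw [alternates_append_singleton]
    refine ⟨h₃, ?_⟩
    simp [wrap, openMove, Nat.even_add_one, hv]
  · simpa [outMove] using h₄
  · rw [mem_ternaryGame_legal]
    refine Or.inr (Or.inr ⟨a, ha, ?_⟩)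
    simp [wrap, openMove, outMove]

theorem infGame_open {x : InfMove} (h : [x] ∈ (infGame q p t).legal n) : x = openMove := by
  obtain ⟨h₁, h₂, h₃⟩ := h
  rcases x with (_ | x) | ⟨c, m⟩ | (_ | x)
  · simp [Alternates] at h₁
  · simp [Alternates] at h₂
  · have := h₃.2.1.1
    simp only [restrictRight_inr, restrictRight_nil, restrictLeft_inl, restrictLeft_nil,
      Alternates] at this
    have h := h₁.1
    simp only [Sum.elim_inr, Sum.elim_inl] at h
    rw [this.1] at h
    simp at h
  · rfl
  · simp [Alternates] at h₁

/-- While the second-order function is running, the opponent can only move in its copy. -/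
theorem infGame_opponent {v : List SofMove} {x : InfMove}
    (h : wrap v ++ [x] ∈ (infGame q p t).legal n) (hv : Odd v.length) : ∃ m, x = callMove m := by
  obtain ⟨h₁, h₂, h₃⟩ := h
  have hx := ((alternates_append_singleton _ _ _).1 h₁).2.1 (by
    rw [length_wrap]
    exact hv.add_odd odd_one)
  rcases x with (_ | x) | ⟨c, m⟩ | (_ | x)
  · simp at hx
  · simp [Alternates, wrap, openMove] at h₂
  · have := h₃.2.1.2.2.1 (c, m) (by simp)
    simp only [Pol.ofPolynomial, Polynomial.eval_one, Nat.lt_one_iff] at this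
    exact ⟨m, by rw [callMove, this]⟩
  · have := h₃.2.2
    rw [mem_ternaryGame_legal] at this
    simp [wrap, openMove] at this
  · simp at hx

theorem infGame_finished {v : List SofMove} {a : List (Option Bool)} {x : InfMove}
    (h : wrap v ++ [outMove a] ++ [x] ∈ (infGame q p t).legal n) (hv : Even v.length) : False := by
  obtain ⟨h₁, h₂, h₃⟩ := h
  have hx := ((alternates_append_singleton _ _ _).1 h₁).2.1 (by
    simp [hv])
  rcases x with (_ | x) | ⟨c, m⟩ | (_ | x)
  · simp at hx
  · simp [Alternates, wrap, openMove, outMove] at h₂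
  · have h := h₃.2.1.1
    simp only [restrictRight_append, restrictRight_inr, restrictRight_nil, restrictLeft_append,
      restrictLeft_inl, restrictLeft_nil] at h
    have := ((alternates_append_singleton _ _ _).1 h).2.1 (by
      simpa [wrap, openMove, outMove] using hv)
    simp only [Sum.elim_inr, Sum.elim_inl] at hx this
    rw [this] at hx
    simp at hx
  · have := h₃.2.2
    rw [mem_ternaryGame_legal] at this
    simp [wrap, openMove, outMove] at this
  · simp at hx

/-- The reply after `wrap v`: run the second-order function on the constantly false predicate and
output the blocks that it has queried. -/
def infReply (rec : Bool) (N : ℕ) (v : List SofMove) : InfMove :=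
  match sofReply (fun _ => false) v with
  | some x => callMove x
  | none => outMove (certificate rec N v)

/-- The plays of the second-order function that arise when it is run on the constantly false
predicate and the strategy is to move. -/
def Pending (q p : Pol) (n : ℕ) (v : List SofMove) : Prop :=
  v ∈ (sofGame q p).legal n ∧ Even v.length ∧ Follows (fun _ => false) v

open scoped Classical in
/-- The next move of the strategy, defined exactly on the histories `wrap v` for pending `v`. -/
def infNext (q p t : Pol) (rec : Bool) (n : ℕ) (s : List InfMove) : Option InfMove :=
  if h : ∃ v, s = wrap v ∧ Pending q p n v then some (infReply rec (t n) h.choose) else none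

theorem infNext_eq_some {rec : Bool} {s : List InfMove} {x : InfMove} :
    infNext q p t rec n s = some x ↔
      ∃ v, s = wrap v ∧ Pending q p n v ∧ x = infReply rec (t n) v := by
  unfold infNext
  constructor
  · intro h
    split_ifs at h with hv
    exact ⟨_, hv.choose_spec.1, hv.choose_spec.2, (Option.some.inj h).symm⟩
  · rintro ⟨v, hs, hv, rfl⟩
    have h : ∃ v, s = wrap v ∧ Pending q p n v := ⟨v, hs, hv⟩
    rw [dif_pos h]
    have : h.choose = v := wrap_injective (h.choose_spec.1.symm.trans hs)
    rw [this]

theorem infNext_isSome {rec : Bool} {s : List InfMove} :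
    (infNext q p t rec n s).isSome ↔ ∃ v, s = wrap v ∧ Pending q p n v := by
  rw [Option.isSome_iff_exists]
  simp only [infNext_eq_some]
  constructor
  · rintro ⟨x, v, h, h', -⟩
    exact ⟨v, h, h'⟩
  · rintro ⟨v, h, h'⟩
    exact ⟨_, v, h, h', rfl⟩

/-- The strategy that runs the second-order function on the constantly false predicate and outputs
the partial function that is `false` on the queried blocks. -/
def infvar (q p t : Pol) (rec : Bool) : Strategy (infGame q p t) where
  next := infNext q p t rec
  domain n s h := by
    obtain ⟨v, rfl, hv⟩ := infNext_isSome.1 h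
    exact ⟨wrap_legal hv.1, by rw [length_wrap]; exact hv.2.1.add_odd odd_one⟩
  legal n s x h := by
    obtain ⟨v, rfl, hv, rfl⟩ := infNext_eq_some.1 h
    unfold infReply
    split
    · rename_i x hx
      have := wrap_legal (t := t) (sof_reply_legal hv.1 hx)
      simpa using this
    · exact outMove_legal hv.1 hv.2.1 (by simp)
  deterministic n s x y h := by
    obtain ⟨v, hs, hv⟩ := infNext_isSome.1 h
    rw [infNext_eq_some]
    rcases List.eq_nil_or_concat v with rfl | ⟨v, b, rfl⟩
    · have := congrArg List.length hs
      simp at this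
    rcases List.eq_nil_or_concat v with rfl | ⟨v, a, rfl⟩
    · simp [Pending, Nat.even_add_one] at hv
    simp only [List.concat_eq_append, List.append_assoc, List.cons_append, List.nil_append] at hs hv
    rw [wrap_append] at hs
    obtain ⟨rfl, h'⟩ := List.append_inj' hs rfl
    simp only [List.map_cons, List.map_nil, List.cons.injEq, and_true] at h'
    obtain ⟨hl, he, hf⟩ := hv
    have he' : Even v.length := by
      simpa [Nat.even_add, parity_simps] using he
    refine ⟨v, rfl, ⟨(sofGame q p).prefix_closed n _ _ hl, he', hf.prefix⟩, ?_⟩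
    rw [h'.1, infReply, hf v a [b] rfl he']
  total n s x hs hl := by
    rw [infNext_isSome]
    rcases hs with hs | ⟨s, y, hs, rfl⟩
    · obtain rfl : s = [] := hs
      exact ⟨[], by rw [infGame_open hl]; rfl, (sofGame q p).nil_legal n, by simp, Follows.nil _⟩
    · obtain ⟨v, rfl, hv, rfl⟩ := infNext_eq_some.1 hs
      unfold infReply at hl ⊢
      split at hl
      · rename_i y hy
        have e : wrap v ++ [callMove y] = wrap (v ++ [y]) := by simp
        rw [e] at hl
        obtain ⟨m, rfl⟩ := infGame_opponent hl (by
          rw [List.length_append]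
          exact hv.2.1.add_odd odd_one)
        have e' : wrap (v ++ [y]) ++ [callMove m] = wrap (v ++ [y, m]) := by simp
        rw [e'] at hl
        refine ⟨v ++ [y, m], by simp, sof_legal_of_wrap hl, ?_,
          hv.2.2.append_round hv.2.1 hy⟩
        rw [List.length_append]
        exact hv.2.1.add even_two
      · exact (infGame_finished hl hv.2.1).elim

end

end ParamGames

namespace ParamGames

noncomputable section

variable {q p t : Pol} {n : ℕ}

/-! ### Runs of a second-order function -/

theorem predPlays_reply {φ : List.Vector Bool n → Bool} {ψ : List Bool → Bool}
    (hψ : ∀ w : List.Vector Bool n, ψ w.toList = φ w) {s u : List PredMove} {x y : PredMove}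
    (h : s ++ x :: y :: u ∈ predPlays φ) (hy : predGame.isOpp y = false) (j : ℕ) :
    replyTo ψ (Sum.inl (j, x)) = some (Sum.inl (j, y)) := by
  rcases h with (h | h) | ⟨w, h⟩
  · simp at h
  · rcases s with _ | ⟨a, _ | ⟨b, s⟩⟩ <;> simp at h
    obtain ⟨rfl, rfl, -⟩ := h
    rfl
  · rcases s with _ | ⟨a, _ | ⟨b, _ | ⟨c, _ | ⟨d, s⟩⟩⟩⟩ <;> simp at h
    · obtain ⟨rfl, rfl, -⟩ := h
      rfl
    · obtain ⟨-, rfl, rfl, -⟩ := h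
      simp at hy
    · obtain ⟨-, -, rfl, rfl, -⟩ := h
      simp [replyTo, hψ]

theorem sof_head {x : SofMove} {s : List SofMove} (h : x :: s ∈ (sofGame q p).legal n) :
    x = Sum.inr none := by
  obtain ⟨h₁, h₂, -⟩ := h
  rcases x with ⟨j, y⟩ | (_ | a)
  · have h₃ := h₁.1
    have h₄ := h₂.1.1
    simp only [Sum.elim_inl] at h₃ h₄
    rw [h₄] at h₃
    simp at h₃
  · rfl
  · simp [Alternates] at h₁

theorem strGame_question {s u : List (Option (List Bool))}
    (h : s ++ none :: u ∈ (strGame p).legal n) : s = [] := by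
  rw [mem_strGame_legal] at h
  rcases h with h | h | ⟨a, -, h⟩
  · simp at h
  · rcases s with _ | ⟨b, s⟩ <;> simp at h ⊢
  · rcases s with _ | ⟨b, _ | ⟨c, s⟩⟩ <;> simp at h ⊢

/-- If the threads of a play of a second-order function are plays of the strategy of `φ`, then all
opponent moves in it are the immediate replies on behalf of `φ`. -/
theorem follows_of_predPlays {φ : List.Vector Bool n → Bool} {ψ : List Bool → Bool}
    (hψ : ∀ w : List.Vector Bool n, ψ w.toList = φ w) {s : List SofMove}
    (hs : s ∈ (sofGame q p).legal n) (ht : ∀ j, thread j (restrictLeft s) ∈ predPlays φ) :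
    Follows ψ s := by
  rintro u x w rfl he
  have hu : u ++ [x] ∈ (sofGame q p).legal n :=
    (sofGame q p).prefix_closed n _ w (by simpa using hs)
  have hx := ((alternates_append_singleton _ _ _).1 hu.1).2.1 he
  rcases List.eq_nil_or_concat u with rfl | ⟨u, m, rfl⟩
  · rw [sof_head hu, sofReply_nil]
  · rw [List.concat_eq_append] at *
    rw [sofReply_append_singleton]
    rcases x with ⟨j, y⟩ | (_ | a)
    · have hy : predGame.isOpp y = false := by simpa using hx
      obtain ⟨h₁, h₂, h₃⟩ := hu
      rw [restrictLeft_append] at h₂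
      have hp := ((alternates_append_singleton _ _ _).1 h₂.1).2
      have ho : Odd (restrictLeft (u ++ [m])).length := by
        rw [← Nat.not_even_iff_odd, hp, hy]
        simp
      have hl := restrict_length (u ++ [m])
      have ho' : Odd (restrictRight (u ++ [m])).length := by
        rw [hl] at he
        rcases Nat.even_or_odd (restrictRight (u ++ [m])).length with h | h
        · exact absurd he (Nat.not_even_iff_odd.2 (ho.add_even h))
        · exact h
      have hr : restrictRight (u ++ [m]) = [none] := by
        rw [restrictRight_append, restrictRight_inl, restrictRight_nil, List.append_nil,
          mem_strGame_legal] at h₃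
        rcases h₃ with h | h | ⟨a, -, h⟩
        · rw [h] at ho'
          simp at ho'
        · exact h
        · rw [h] at ho'
          simp only [List.length_cons, List.length_nil] at ho'
          exact absurd ho' (by decide)
      rcases m with ⟨j', y'⟩ | m
      · have hb : restrictLeft u ++ [(j', y'), (j, y)] ∈ (bang q predGame).legal n := by
          simpa using h₂
        obtain rfl := bang_switching hb hy
        refine predPlays_reply hψ (s := thread j (restrictLeft u))
          (u := thread j (restrictLeft w)) ?_ hy j
        have := ht j
        simpa using this
      · have hr' : restrictRight u = [] ∧ m = none := by
          rw [restrictRight_append] at hr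
          have := List.append_inj' (s₂ := []) hr rfl
          simpa using this
        rcases u with _ | ⟨z, u⟩
        · simp at he
        · have hz : z = Sum.inr none := sof_head (q := q) (p := p) (n := n) (s := u)
            ((sofGame q p).prefix_closed n _ (Sum.inr m :: Sum.inl (j, y) :: w)
              (by simpa using hs))
          simp [hz] at hr'
    · have h₃ := hu.2.2
      rw [restrictRight_append] at h₃
      have := strGame_question h₃
      rcases u with _ | ⟨z, u⟩
      · simp at he
      · have hz : z = Sum.inr none := sof_head (q := q) (p := p) (n := n) (s := u)
          ((sofGame q p).prefix_closed n _ (m :: Sum.inr none :: w) (by simpa using hs))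
        simp [hz] at this
    · simp at hx

/-- By parity, a play in which the second-order function has answered and it is the opponent's turn
cannot continue in a predicate. -/
theorem sof_ends_with_answer {s : List SofMove} {a : List Bool}
    (hs : s ∈ (sofGame q p).legal n) (he : Even s.length)
    (ha : restrictRight s = [none, some a]) : ∃ u, s = u ++ [Sum.inr (some a)] := by
  rcases List.eq_nil_or_concat s with rfl | ⟨u, m, rfl⟩
  · simp at ha
  rw [List.concat_eq_append] at *
  rcases m with ⟨j, y⟩ | m
  · exfalso
    obtain ⟨h₁, h₂, -⟩ := hs
    have hy := ((alternates_append_singleton _ _ _).1 h₁).2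
    have ho : ¬ Even u.length := by simpa [Nat.even_add_one] using he
    rw [iff_false_left ho] at hy
    rw [restrictLeft_append] at h₂
    have hp := ((alternates_append_singleton _ _ _).1 h₂.1).2.2 (by
      simp only [Sum.elim_inl] at hy ⊢
      simpa using hy)
    have hl := restrict_length u
    have hr : (restrictRight u).length = 2 := by
      have := congrArg List.length ha
      simpa using this
    rw [hl, hr] at ho
    exact ho (hp.add even_two)
  · rw [restrictRight_append] at ha
    have := List.append_inj' (s₁ := restrictRight u) (s₂ := [none]) ha rfl
    simp only [restrictRight_inr, restrictRight_nil, List.cons.injEq, and_true] at this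
    exact ⟨u, by rw [this.2]⟩

/-! ### Determinacy -/

namespace Strategy

variable {G : Game} (f : Strategy G)

theorem legal_of_mem_plays {s : List G.Move} (h : s ∈ f.plays n) : s ∈ G.legal n := by
  rcases h with h | ⟨s, x, h, rfl⟩
  · obtain rfl : s = [] := h
    exact G.nil_legal n
  · exact f.legal n s x h

theorem even_of_mem_plays {s : List G.Move} (h : s ∈ f.plays n) : Even s.length := by
  rcases h with h | ⟨s, x, h, rfl⟩
  · obtain rfl : s = [] := h
    simp
  · rw [List.length_append]
    exact (f.domain n s (by simp [h])).2.add_odd odd_one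

theorem next_of_append_singleton_mem_plays {s : List G.Move} {x : G.Move}
    (h : s ++ [x] ∈ f.plays n) : f.next n s = some x := by
  rcases h with h | ⟨s', x', h, hs⟩
  · simp at h
  · obtain ⟨rfl, h'⟩ := List.append_inj' hs rfl
    simp only [List.cons.injEq, and_true] at h'
    rw [h', h]

theorem mem_plays_of_append_pair {s : List G.Move} {x y : G.Move}
    (h : s ++ [x, y] ∈ f.plays n) : s ∈ f.plays n := by
  rcases List.eq_nil_or_concat s with rfl | ⟨s, z, rfl⟩
  · exact Or.inl rfl
  · rw [List.concat_eq_append] at h ⊢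
    have := f.next_of_append_singleton_mem_plays (s := s ++ [z, x]) (x := y) (by simpa using h)
    exact Or.inr ⟨s, z, f.deterministic n s z x (by simp [this]), rfl⟩

theorem next_of_mem_plays {s w : List G.Move} {x : G.Move} :
    ∀ (_ : s ++ x :: w ∈ f.plays n) (_ : Even w.length), f.next n s = some x := by
  intro h he
  obtain ⟨k, hk⟩ := he
  induction k generalizing w with
  | zero =>
    obtain rfl : w = [] := List.length_eq_zero_iff.1 hk
    exact f.next_of_append_singleton_mem_plays h
  | succ k ih =>
    rcases List.eq_nil_or_concat w with rfl | ⟨w, b, rfl⟩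
    · simp at hk
    rcases List.eq_nil_or_concat w with rfl | ⟨w, a, rfl⟩
    · simp at hk
      omega
    simp only [List.concat_eq_append, List.append_assoc, List.cons_append, List.nil_append,
      List.length_append, List.length_cons, List.length_nil] at h hk
    refine ih (f.mem_plays_of_append_pair (x := a) (y := b) (by simpa using h)) ?_
    omega

end Strategy

/-- Two runs of a second-order function on the same predicate are comparable: the moves of one side
are fixed by `Follows`, those of the other by the strategy. The induction is on the number `k` of
rounds of the shorter run. -/
theorem plays_prefix (f : Strategy (sofGame q p)) {ψ : List Bool → Bool} :
    ∀ (k : ℕ) (s s' : List SofMove), s ∈ f.plays n → s' ∈ f.plays n → Follows ψ s →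
      Follows ψ s' → s.length = 2 * k → s.length ≤ s'.length → s <+: s' := by
  intro k
  induction k with
  | zero =>
    intro s s' _ _ _ _ hk _
    obtain rfl : s = [] := List.length_eq_zero_iff.1 (by simpa using hk)
    exact List.nil_prefix
  | succ k ih =>
    intro s s' hs hs' hf hf' hk hle
    rcases List.eq_nil_or_concat s with rfl | ⟨s, y, rfl⟩
    · simp at hk
    rcases List.eq_nil_or_concat s with rfl | ⟨s, x, rfl⟩
    · simp at hk
      omega
    simp only [List.concat_eq_append, List.append_assoc, List.cons_append, List.nil_append] at *
    have hl : s.length = 2 * k := by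
      simp only [List.length_append, List.length_cons, List.length_nil] at hk
      omega
    have hp := f.mem_plays_of_append_pair hs
    obtain ⟨r, rfl⟩ := ih s s' hp hs' hf.prefix hf' hl (by
      refine le_trans ?_ hle
      simp)
    have hr := f.even_of_mem_plays hs'
    rcases r with _ | ⟨x', _ | ⟨y', r⟩⟩
    · simp at hle
    · simp at hle
    · have hes : Even s.length := by simp [hl]
      have hx : x = x' := by
        have h₁ := hf s x [y] rfl hes
        have h₂ := hf' s x' (y' :: r) rfl hes
        rw [h₁] at h₂
        exact Option.some.inj h₂
      subst hx
      have h₁ := f.next_of_mem_plays (s := s ++ [x]) (x := y) (w := []) (by simpa using hs)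
        (by simp)
      have h₂ := f.next_of_mem_plays (s := s ++ [x]) (x := y') (w := r) (by simpa using hs') (by
        rw [List.length_append, List.length_cons, List.length_cons] at hr
        simpa [parity_simps, hes] using hr)
      rw [h₁] at h₂
      rw [Option.some.inj h₂]
      exact ⟨r, by simp⟩

theorem answer_unique (f : Strategy (sofGame q p)) {ψ : List Bool → Bool} {s s' : List SofMove}
    {a a' : List Bool} (hs : s ∈ f.plays n) (hs' : s' ∈ f.plays n) (hf : Follows ψ s)
    (hf' : Follows ψ s') (ha : restrictRight s = [none, some a])
    (ha' : restrictRight s' = [none, some a']) : a = a' := by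
  wlog hle : s.length ≤ s'.length generalizing s s' a a'
  · exact (this hs' hs hf' hf ha' ha (by omega)).symm
  obtain ⟨k, hk⟩ := f.even_of_mem_plays hs
  obtain ⟨r, rfl⟩ := plays_prefix f k s s' hs hs' hf hf' (by omega) hle
  rw [restrictRight_append, ha] at ha'
  simp at ha'
  exact ha'.1

/-! ### The queried blocks determine the value -/

theorem mem_queries {v : List SofMove} {w : List Bool} :
    w ∈ queries v ↔ ∃ j, Sum.inl (j, Sum.inl (some w)) ∈ v := by
  unfold queries
  rw [List.mem_filterMap]
  constructor
  · rintro ⟨⟨j, (_ | w') | y⟩ | a, h, hw⟩ <;> simp at hw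
    exact ⟨j, hw ▸ h⟩
  · rintro ⟨j, h⟩
    exact ⟨_, h, rfl⟩

theorem mem_of_mem_thread {M : Type} {j : ℕ} {x : M} {s : List (ℕ × M)} (h : x ∈ thread j s) :
    (j, x) ∈ s := by
  obtain ⟨⟨i, y⟩, hm, h⟩ := List.mem_filterMap.1 h
  dsimp only at h
  split_ifs at h with hi
  rwa [← hi, ← Option.some.inj h]

theorem mem_of_mem_restrictLeft {M N : Type} {x : M} {s : List (M ⊕ N)}
    (h : x ∈ restrictLeft s) : Sum.inl x ∈ s := by
  obtain ⟨y, hm, h⟩ := List.mem_filterMap.1 h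
  rcases y with y | y
  · rwa [← Option.some.inj h]
  · simp at h

/-- The value of a second-order function at `φ` is determined by the values of `φ` at the queried
arguments. -/
theorem Strategy.Computes.eq_of_queries {f : Strategy (sofGame q p)}
    {F : ∀ n, (List.Vector Bool n → Bool) → List.Vector Bool (p n)} (hF : f.Computes F)
    {φ φ' : List.Vector Bool n → Bool} {s : List SofMove} (hs : s ∈ f.plays n)
    (hs' : restrictLeft s ∈ bangPlays q predGame n (predPlays φ))
    (ha : restrictRight s = [none, some (F n φ).toList])
    (hφ : ∀ w : List.Vector Bool n, w.toList ∈ queries s → φ' w = φ w) : F n φ' = F n φ := by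
  obtain ⟨u, hu, hu', hb⟩ := hF n φ'
  -- `s` is also a run on `φ'`, so that it has to agree with the run `u` that computes `F n φ'`.
  let ψ : List Bool → Bool := fun l => if h : l.length = n then φ' ⟨l, h⟩ else false
  have hψ : ∀ w : List.Vector Bool n, ψ w.toList = φ' w := fun w => by
    simp only [ψ, List.Vector.toList_length, dite_true]
    rfl
  have h₁ : Follows ψ s := by
    refine follows_of_predPlays (q := q) (p := p) hψ (f.legal_of_mem_plays hs) fun j => ?_
    rcases hs'.2 j with h | ⟨w, h⟩
    · exact Or.inl h
    · refine Or.inr ⟨w, ?_⟩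
      rw [h, hφ w]
      rw [mem_queries]
      exact ⟨j, mem_of_mem_restrictLeft (mem_of_mem_thread (by rw [h]; simp))⟩
  have h₂ : Follows ψ u := follows_of_predPlays hψ (f.legal_of_mem_plays hu) hu'.2
  exact List.Vector.toList_injective (answer_unique f hu hs h₂ h₁ hb ha)

/-! ### The number of queries -/

theorem countP_eq_sum_thread {M : Type} (P : M → Bool) (k : ℕ) (s : List (ℕ × M))
    (h : ∀ m ∈ s, m.1 < k) :
    s.countP (fun m => P m.2) = ∑ i ∈ Finset.range k, (thread i s).countP P := by
  induction s with
  | nil => simp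
  | cons x s ih =>
    obtain ⟨j, x⟩ := x
    have hj : j < k := h _ List.mem_cons_self
    have : ∀ i, (thread i ((j, x) :: s)).countP P =
        (if j = i then (if P x then 1 else 0) else 0) + (thread i s).countP P := by
      intro i
      by_cases hi : j = i
      · subst hi
        simp [List.countP_cons, add_comm]
      · simp [thread_cons_of_ne hi, hi]
    simp_rw [this, Finset.sum_add_distrib, ← ih fun m hm => h m (List.mem_cons_of_mem _ hm)]
    simp [List.countP_cons, hj, add_comm]

/-- Whether a move is an argument for a predicate. -/
def isArgument : PredMove → Bool
  | Sum.inl (some _) => true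
  | _ => false

theorem countP_isArgument_le {s : List PredMove} (h : s ∈ predGame.legal n) :
    s.countP isArgument ≤ 1 := by
  have h₁ : s.countP isArgument = (restrictLeft s).countP Option.isSome := by
    clear h
    induction s with
    | nil => rfl
    | cons x s ih => rcases x with (_ | x) | x <;> simp [List.countP_cons, isArgument, ih]
  rw [h₁]
  have := h.2.1
  rw [mem_strGame_legal] at this
  rcases this with h | h | ⟨a, -, h⟩ <;> simp [h]

/-- A second-order function makes at most one query in each of its `q n` threads. -/
theorem length_queries_le {s : List SofMove} (h : s ∈ (sofGame q p).legal n) :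
    (queries s).length ≤ q n := by
  have h₁ : (queries s).length = (restrictLeft s).countP fun m => isArgument m.2 := by
    clear h
    unfold queries
    induction s with
    | nil => rfl
    | cons x s ih =>
      rcases x with ⟨j, (_ | w) | y⟩ | a <;> simp [isArgument, ih]
  rw [h₁, countP_eq_sum_thread _ (q n) _ h.2.1.2.2.1]
  have := Finset.sum_le_card_nsmul (Finset.range (q n))
    (fun i => (thread i (restrictLeft s)).countP isArgument) 1
    fun i _ => countP_isArgument_le (h.2.1.2.1 i)
  simpa using this

/-! ### Blocks -/

theorem foldl_binary (w : List Bool) (I : ℕ) :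
    w.foldl (fun a b => 2 * a + b.toNat) I = I * 2 ^ w.length + binVal w := by
  induction w using List.reverseRecOn with
  | nil => simp [binVal]
  | append_singleton w b ih =>
    simp only [List.foldl_append, List.foldl_cons, List.foldl_nil, ih, binVal, List.length_append,
      List.length_singleton]
    ring

/-- Reading a word, starting with `2 ^ m` blocks, keeps its `m` leading bits. -/
theorem foldl_blockIdx (w : List Bool) (m I : ℕ) :
    (w.foldl blockStep (2 ^ m, I)).2 =
      w.foldl (fun a b => 2 * a + b.toNat) I / 2 ^ (w.length - m) := by
  have h₀ : ∀ (w : List Bool) (I : ℕ),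
      w.foldl blockStep (1, I) = (1, I) := by
    intro w I
    induction w with
    | nil => rfl
    | cons b w ih => simpa [blockStep] using ih
  induction w generalizing m I with
  | nil => simp
  | cons b w ih =>
    rcases m with _ | m
    · rw [pow_zero, h₀, foldl_binary, Nat.sub_zero, Nat.mul_comm,
        Nat.mul_add_div (by positivity), Nat.div_eq_of_lt (binVal_lt _)]
      simp
    · have h2 : 2 ≤ 2 ^ (m + 1) := by
        rw [pow_succ]
        have := Nat.one_le_two_pow (n := m)
        omega
      have hd : 2 ^ (m + 1) / 2 = 2 ^ m := by
        rw [pow_succ, Nat.mul_div_cancel _ two_pos]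
      simp only [List.foldl_cons, blockStep, if_pos h2, hd, ih, List.length_cons, Nat.add_sub_add_right]

theorem blockIdx_eq {N : ℕ} (hN : N ∣ 2 ^ n) (w : List.Vector Bool n) :
    blockIdx N w.toList = binVal w.toList / (2 ^ n / N) := by
  obtain ⟨m, hm, rfl⟩ := (Nat.dvd_prime_pow Nat.prime_two).1 hN
  rw [blockIdx, foldl_blockIdx, Nat.pow_div hm two_pos, List.Vector.toList_length]
  rfl

theorem getElem?_markBlocks (N : ℕ) (ws : List (List Bool)) (i : ℕ) (hi : i < N) :
    (markBlocks N ws)[i]? = some (if ∃ w ∈ ws, blockIdx N w = i then some false else none) := by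
  unfold markBlocks
  induction ws using List.reverseRecOn with
  | nil => simp [hi]
  | append_singleton ws w ih =>
    rw [List.foldl_append, List.foldl_cons, List.foldl_nil, List.getElem?_set, ih]
    have hl : (ws.foldl (fun L w => L.set (blockIdx N w) (some false))
        (List.replicate N none)).length = N := by
      rw [length_foldl_set, List.length_replicate]
    rw [hl]
    by_cases h : blockIdx N w = i
    · simp [h, hi]
    · simp [h, or_and_right, exists_or]

/-- The partial function that is `false` on the queried blocks. -/
def markFun (N : ℕ) (ws : List (List Bool)) (i : Fin N) : Option Bool :=
  open Classical in if ∃ w ∈ ws, blockIdx N w = i then some false else none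

theorem ofFn_markFun (N : ℕ) (ws : List (List Bool)) :
    List.ofFn (markFun N ws) = markBlocks N ws := by
  have hl : (markBlocks N ws).length = N := by
    rw [markBlocks, length_foldl_set, List.length_replicate]
  refine List.ext_getElem? fun i => ?_
  by_cases hi : i < N
  · rw [getElem?_markBlocks N ws i hi, List.getElem?_ofFn, dif_pos hi]
    simp only [markFun]
  · rw [List.getElem?_eq_none (by simpa using hi), List.getElem?_eq_none (by rw [hl]; omega)]

theorem domCard_markFun_le (N : ℕ) (ws : List (List Bool)) :
    domCard (markFun N ws) ≤ ws.length := by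
  classical
  have h : ((Finset.univ.filter fun j => (markFun N ws j).isSome).map Fin.valEmbedding) ⊆
      (ws.map (blockIdx N)).toFinset := by
    intro i hi
    simp only [Finset.mem_map, Finset.mem_filter, Finset.mem_univ, true_and] at hi
    obtain ⟨j, hj, rfl⟩ := hi
    unfold markFun at hj
    split_ifs at hj with h
    · simpa using h
    · simp at hj
  have := Finset.card_le_card h
  rw [Finset.card_map] at this
  exact this.trans ((List.toFinset_card_le _).trans (by simp))

/-! ### Variance -/

theorem variance_eq_zero {α β : Type} [Fintype α] {D : α → ℝ} {F : α → β} (c : β)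
    (h : ∀ x, D x ≠ 0 → F x = c) : variance D F = 0 := by
  unfold variance
  refine Finset.sum_eq_zero fun x _ => Finset.sum_eq_zero fun y _ => ?_
  split_ifs with hne
  · by_contra h0
    exact hne (by rw [h x (left_ne_zero_of_mul h0), h y (right_ne_zero_of_mul h0)])
  · rfl

theorem variance_le_one {α β : Type} [Fintype α] {D : α → ℝ} {F : α → β} (h₀ : ∀ x, 0 ≤ D x)
    (h₁ : ∑ x, D x = 1) : variance D F ≤ 1 := by
  unfold variance
  calc _ ≤ ∑ x, ∑ y, D x * D y := by
        refine Finset.sum_le_sum fun x _ => Finset.sum_le_sum fun y _ => ?_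
        split_ifs
        · exact le_rfl
        · exact mul_nonneg (h₀ x) (h₀ y)
    _ = 1 := by simp_rw [← Finset.mul_sum, h₁, mul_one, h₁]

theorem exists_of_pushforward_ne_zero {α β : Type} [Fintype α] {h : α → β} {D : α → ℝ} {y : β}
    (hy : pushforward h D y ≠ 0) : ∃ x, h x = y ∧ D x ≠ 0 := by
  obtain ⟨x, -, hx⟩ := Finset.exists_ne_zero_of_sum_ne_zero hy
  split_ifs at hx with hxy
  · exact ⟨x, hxy, hx⟩
  · exact absurd rfl hx

theorem semiUniform_nonneg {N : ℕ} (g : Fin N → Option Bool) (x : Fin N → Bool) :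
    0 ≤ semiUniform g x := by
  unfold semiUniform
  split_ifs
  · positivity
  · exact le_rfl

theorem sum_semiUniform_none (N : ℕ) :
    ∑ x : Fin N → Bool, semiUniform (fun _ => none) x = 1 := by
  have h : ∀ x : Fin N → Bool, semiUniform (fun _ => none) x = 1 / 2 ^ N := by
    intro x
    simp [semiUniform, domCard]
  simp [h]

theorem variance_none_le_one {N : ℕ} {β : Type} (hN : N ∣ 2 ^ n)
    (F : (List.Vector Bool n → Bool) → β) :
    variance (pushforward (extension hN) (semiUniform fun _ => none)) F ≤ 1 := by
  classical
  refine variance_le_one (fun y => Finset.sum_nonneg fun x _ => ?_) ?_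
  · split_ifs
    · exact semiUniform_nonneg _ _
    · exact le_rfl
  · unfold pushforward
    rw [Finset.sum_comm, ← sum_semiUniform_none N]
    refine Finset.sum_congr rfl fun x _ => ?_
    exact (Finset.sum_eq_single (extension hN x) (fun y _ hy => if_neg (Ne.symm hy))
      fun h => absurd (Finset.mem_univ _) h).trans (if_pos rfl)

/-- A completed run on the constantly false predicate is a certificate: the function computed is
constant on the predicates that are `false` on the queried blocks. -/
theorem variance_markFun {f : Strategy (sofGame q p)}
    {F : ∀ n, (List.Vector Bool n → Bool) → List.Vector Bool (p n)} (hF : f.Computes F)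
    {N : ℕ} (hN : N ∣ 2 ^ n) {s : List SofMove} (hs : s ∈ f.plays n)
    (hs' : restrictLeft s ∈ bangPlays q predGame n (predPlays fun _ : List.Vector Bool n => false))
    (ha : restrictRight s = [none, some (F n fun _ : List.Vector Bool n => false).toList]) :
    variance (pushforward (extension hN) (semiUniform (markFun N (queries s)))) (F n) = 0 := by
  refine variance_eq_zero (F n fun _ => false) fun φ hφ => ?_
  obtain ⟨x, rfl, hx⟩ := exists_of_pushforward_ne_zero hφ
  refine hF.eq_of_queries hs hs' ha fun w hw => ?_
  have hx' : ∀ j b, markFun N (queries s) j = some b → x j = b := by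
    by_contra h
    exact hx (if_neg h)
  refine hx' _ _ ?_
  unfold markFun
  rw [if_pos]
  exact ⟨_, hw, blockIdx_eq hN w⟩

end

end ParamGames

namespace ParamGames

open Turing

/-! ### A Turing machine for the strategy -/

/-- What the last move read by the machine asks for: `opening` for the initial question, `query` and
`argument` for the moves of the second-order function in a predicate, `answer` for its final answer,
and `own` for the moves of the strategy. -/
inductive Mode
  | opening
  | own
  | query
  | argument
  | answer
  deriving DecidableEq

instance : Fintype Mode :=
  Fintype.ofList [.opening, .own, .query, .argument, .answer]
    (by intro x; cases x <;> simp)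

/-- The stacks of the machine besides those of the subroutine: the input and the output, the thread
number of the current move, the cells of the partial function, the number of blocks not yet halved
away, the block index, and stacks on which some of these are stored temporarily. -/
inductive Stk
  | inp
  | out
  | thr
  | cells
  | tmp
  | blocks
  | half
  | idx
  | dbl
  deriving DecidableEq

instance : Fintype Stk :=
  Fintype.ofList [.inp, .out, .thr, .cells, .tmp, .blocks, .half, .idx, .dbl]
    (by intro x; cases x <;> simp)

/-- The labels of the machine besides those of the subroutine. -/
inductive Lbl
  | ticks
  | init
  | move
  | clearThr
  | readThr
  | readAnswer
  | readArg
  | halve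
  | unhalve
  | double
  | undouble
  | clearBlocks
  | mark
  | unmark
  | finish
  | writeThr
  | dumpCells
  | writeCells
  | cleanThr
  | cleanCells
  | cleanBlocks
  deriving DecidableEq

instance : Fintype Lbl :=
  Fintype.ofList [.ticks, .init, .move, .clearThr, .readThr, .readAnswer, .readArg, .halve,
    .unhalve, .double, .undouble, .clearBlocks, .mark, .unmark, .finish, .writeThr, .dumpCells,
    .writeCells, .cleanThr, .cleanCells, .cleanBlocks]
    (by intro x; cases x <;> simp)

/-- The internal state of the machine: the symbol read last, the kind of the last move, whether the
final answer is nonempty, a bit, whether the block index was nonempty, and the internal state of the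
subroutine. -/
structure Reg (σ : Type) where
  top : Option (Option Sym)
  mode : Mode
  flag : Bool
  bit : Bool
  more : Bool
  sub : σ
  deriving Fintype

variable (M : FinTM2)

/-- The stack alphabets. -/
@[reducible] def Alph : Stk ⊕ M.K → Type
  | Sum.inl Stk.inp => Option Sym
  | Sum.inl _ => Sym
  | Sum.inr k => M.Γ k

/-- Statements of the machine. -/
abbrev Prog : Type := TM2.Stmt (Alph M) (Lbl ⊕ M.Λ) (Reg M.σ)

variable {M}

/-- A stack symbol as an input symbol, where `none` is the end marker of the input. -/
def readSym : ∀ k : Stk, Alph M (Sum.inl k) → Option Sym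
  | Stk.inp, a => a
  | Stk.out, a => some a
  | Stk.thr, a => some a
  | Stk.cells, a => some a
  | Stk.tmp, a => some a
  | Stk.blocks, a => some a
  | Stk.half, a => some a
  | Stk.idx, a => some a
  | Stk.dbl, a => some a

/-- A symbol as a stack symbol. -/
def writeSym : ∀ k : Stk, Sym → Alph M (Sum.inl k)
  | Stk.inp, a => some a
  | Stk.out, a => a
  | Stk.thr, a => a
  | Stk.cells, a => a
  | Stk.tmp, a => a
  | Stk.blocks, a => a
  | Stk.half, a => a
  | Stk.idx, a => a
  | Stk.dbl, a => a

namespace Prog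

/-- Pop a symbol and remember it. -/
def pop (k : Stk) (P : Prog M) : Prog M :=
  TM2.Stmt.pop (Sum.inl k) (fun v o => { v with top := o.map (readSym k) }) P

def push (k : Stk) (a : Sym) (P : Prog M) : Prog M :=
  TM2.Stmt.push (Sum.inl k) (fun _ => writeSym k a) P

/-- Push the symbol read last. The default `bot` only serves to make this total. -/
def pushTop (k : Stk) (P : Prog M) : Prog M :=
  TM2.Stmt.push (Sum.inl k) (fun v => writeSym k (v.top.join.getD Sym.bot)) P

/-- Branch on whether the last pop found an empty stack. -/
def ifEmpty (P Q : Prog M) : Prog M :=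
  TM2.Stmt.branch (fun v => v.top.isNone) P Q

/-- Branch on whether the symbol read last is `a`. -/
def ifTop (a : Option Sym) (P Q : Prog M) : Prog M :=
  TM2.Stmt.branch (fun v => decide (v.top = some a)) P Q

def setMode (m : Mode) (P : Prog M) : Prog M :=
  TM2.Stmt.load (fun v => { v with mode := m }) P

def setFlag (b : Bool) (P : Prog M) : Prog M :=
  TM2.Stmt.load (fun v => { v with flag := b }) P

def setBit (b : Bool) (P : Prog M) : Prog M :=
  TM2.Stmt.load (fun v => { v with bit := b }) P

def ifMode (m : Mode) (P Q : Prog M) : Prog M :=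
  TM2.Stmt.branch (fun v => decide (v.mode = m)) P Q

def ifBit (P Q : Prog M) : Prog M :=
  TM2.Stmt.branch (fun v => v.bit) P Q

def go (l : Lbl) : Prog M :=
  TM2.Stmt.goto fun _ => Sum.inl l

/-- A statement of the subroutine, which continues at `init` instead of halting. -/
def ofSub : TM2.Stmt M.Γ M.Λ M.σ → Prog M
  | .push k f P => TM2.Stmt.push (Sum.inr k) (fun v => f v.sub) (ofSub P)
  | .peek k f P => TM2.Stmt.peek (Sum.inr k) (fun v o => { v with sub := f v.sub o }) (ofSub P)
  | .pop k f P => TM2.Stmt.pop (Sum.inr k) (fun v o => { v with sub := f v.sub o }) (ofSub P)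
  | .load f P => TM2.Stmt.load (fun v => { v with sub := f v.sub }) (ofSub P)
  | .branch f P Q => TM2.Stmt.branch (fun v => f v.sub) (ofSub P) (ofSub Q)
  | .goto f => TM2.Stmt.goto fun v => Sum.inr (f v.sub)
  | .halt => go Lbl.init

end Prog

/-- The initial internal state. -/
def Reg.start (M : FinTM2) : Reg M.σ :=
  ⟨none, Mode.own, false, false, false, M.initialState⟩

open Prog in
/-- The program. After the subroutine has turned `1 ^ n` into the number of blocks, the history is
read move by move; the block of each argument is computed as in `blockIdx` and marked. The reply is
then written according to the kind of the last move. -/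
def program (one : M.Γ M.k₀) (rec : Bool) : Lbl ⊕ M.Λ → Prog M
  | Sum.inr l => ofSub (M.m l)
  | Sum.inl Lbl.ticks =>
    pop .inp <| ifTop (some .tick)
      (TM2.Stmt.push (Sum.inr M.k₀) (fun _ => one) <| go .ticks)
      (TM2.Stmt.goto fun _ => Sum.inr M.main)
  | Sum.inl Lbl.init =>
    TM2.Stmt.pop (Sum.inr M.k₁) (fun v o => { v with top := o.map fun _ => none }) <|
      ifEmpty (go .move) <| push .cells .bot <| push .blocks .tick <| go .init
  | Sum.inl Lbl.move =>
    pop .inp <| ifEmpty (go .finish) <| pop .inp <| ifTop (some .right)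
      (pop .inp <| pop .inp <| setMode .opening <| go .move)
      (pop .inp <| pop .inp <| ifTop (some .right)
        (pop .inp <| ifTop (some .ask)
          (pop .inp <| setMode .own <| go .move)
          (setMode .answer <| setFlag false <| go .readAnswer))
        (go .clearThr))
  | Sum.inl Lbl.clearThr => pop .thr <| ifEmpty (go .readThr) (go .clearThr)
  | Sum.inl Lbl.readThr =>
    pop .inp <| ifTop (some .tick) (push .thr .tick <| go .readThr) <|
      pop .inp <| ifTop (some .right)
        (pop .inp <| ifTop (some .ask)
          (pop .inp <| setMode .query <| go .move)
          (pop .inp <| pop .inp <| setMode .own <| go .move))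
        (pop .inp <| ifTop (some .ask)
          (pop .inp <| setMode .own <| go .move)
          (setMode .argument <| go .readArg))
  | Sum.inl Lbl.readAnswer =>
    pop .inp <| ifTop none (go .move) (setFlag true <| go .readAnswer)
  | Sum.inl Lbl.readArg =>
    pop .inp <| ifTop none (setBit false <| go .clearBlocks) <|
      TM2.Stmt.load (fun v => { v with bit := decide (v.top = some (some (.bit true))) }) <|
      pop .blocks <| ifEmpty (go .readArg) <|
      pop .blocks <| ifEmpty (push .blocks .tick <| go .readArg) <|
      push .blocks .tick <| push .blocks .tick <| go .halve
  | Sum.inl Lbl.halve =>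
    pop .blocks <| pop .blocks <| ifEmpty (go .unhalve) <| push .half .tick <| go .halve
  | Sum.inl Lbl.unhalve =>
    pop .half <| ifEmpty (go .double) <| push .blocks .tick <| go .unhalve
  | Sum.inl Lbl.double =>
    pop .idx <| ifEmpty (go .undouble) <| push .dbl .tick <| push .dbl .tick <| go .double
  | Sum.inl Lbl.undouble =>
    pop .dbl <| ifEmpty (ifBit (push .idx .tick <| go .readArg) (go .readArg)) <|
      push .idx .tick <| go .undouble
  | Sum.inl Lbl.clearBlocks => pop .blocks <| ifEmpty (go .mark) (go .clearBlocks)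
  | Sum.inl Lbl.mark =>
    pop .cells <| ifEmpty (go .unmark) <|
      TM2.Stmt.pop (Sum.inl .idx) (fun v o => { v with more := o.isSome }) <|
      TM2.Stmt.branch (fun v => v.more || v.bit) (pushTop .tmp <| go .mark) <|
      push .tmp (.bit false) <| setBit true <| go .mark
  | Sum.inl Lbl.unmark =>
    pop .tmp <| ifEmpty (go .move) <| pushTop .cells <| push .blocks .tick <| go .unmark
  | Sum.inl Lbl.finish =>
    ifMode .opening
      (push .out .ask <| push .out .right <| push .out .sep <| push .out .left <|
        push .out .right <| go .cleanThr) <|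
    ifMode .query (push .out .ask <| push .out .left <| push .out .sep <| go .writeThr) <|
    ifMode .argument
      (push .out (.bit false) <| push .out .ans <| push .out .right <| push .out .sep <|
        go .writeThr) <|
    go .dumpCells
  | Sum.inl Lbl.writeThr =>
    pop .thr <| ifEmpty
      (push .out .left <| push .out .sep <| push .out .left <| push .out .right <| go .cleanThr)
      (push .out .tick <| go .writeThr)
  | Sum.inl Lbl.dumpCells =>
    pop .cells <| ifEmpty (go .writeCells) <|
      TM2.Stmt.branch (fun v => rec && v.flag) (pushTop .tmp <| go .dumpCells)
        (push .tmp .bot <| go .dumpCells)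
  | Sum.inl Lbl.writeCells =>
    pop .tmp <| ifEmpty
      (push .out .ans <| push .out .right <| push .out .right <| go .cleanThr)
      (pushTop .out <| go .writeCells)
  | Sum.inl Lbl.cleanThr => pop .thr <| ifEmpty (go .cleanCells) (go .cleanThr)
  | Sum.inl Lbl.cleanCells => pop .cells <| ifEmpty (go .cleanBlocks) (go .cleanCells)
  | Sum.inl Lbl.cleanBlocks =>
    pop .blocks <| ifEmpty (TM2.Stmt.load (fun _ => Reg.start M) TM2.Stmt.halt) (go .cleanBlocks)

/-- The machine. -/
def machine (M : FinTM2) (one : M.Γ M.k₀) (rec : Bool) : FinTM2 where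
  K := Stk ⊕ M.K
  kDecidableEq := inferInstance
  kFin := haveI := M.kFin; inferInstance
  k₀ := Sum.inl Stk.inp
  k₁ := Sum.inl Stk.out
  Γ := Alph M
  Λ := Lbl ⊕ M.Λ
  main := Sum.inl Lbl.ticks
  ΛFin := haveI := M.ΛFin; inferInstance
  σ := Reg M.σ
  initialState := Reg.start M
  σFin := haveI := M.σFin; inferInstance
  Γk₀Fin := inferInstanceAs (Fintype (Option Sym))
  m := program one rec

/-- The contents of the stacks. -/
def tapes (i : List (Option Sym)) (o c l t b h x d : List Sym) (T : ∀ k, List (M.Γ k)) :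
    ∀ k, List (Alph M k)
  | Sum.inl Stk.inp => i
  | Sum.inl Stk.out => o
  | Sum.inl Stk.thr => c
  | Sum.inl Stk.cells => l
  | Sum.inl Stk.tmp => t
  | Sum.inl Stk.blocks => b
  | Sum.inl Stk.half => h
  | Sum.inl Stk.idx => x
  | Sum.inl Stk.dbl => d
  | Sum.inr k => T k

section tapes

variable (i i' : List (Option Sym)) (o c l t b h x d a : List Sym) (T : ∀ k, List (M.Γ k))

@[simp] theorem update_inp : Function.update (tapes i o c l t b h x d T) (Sum.inl Stk.inp) i' =
    tapes i' o c l t b h x d T := by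
  funext k; rcases k with (_ | _) | _ <;> rfl

@[simp] theorem update_out : Function.update (tapes i o c l t b h x d T) (Sum.inl Stk.out) a =
    tapes i a c l t b h x d T := by
  funext k; rcases k with (_ | _) | _ <;> rfl

@[simp] theorem update_thr : Function.update (tapes i o c l t b h x d T) (Sum.inl Stk.thr) a =
    tapes i o a l t b h x d T := by
  funext k; rcases k with (_ | _) | _ <;> rfl

@[simp] theorem update_cells :
    Function.update (tapes i o c l t b h x d T) (Sum.inl Stk.cells) a =
      tapes i o c a t b h x d T := by
  funext k; rcases k with (_ | _) | _ <;> rfl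

@[simp] theorem update_tmp : Function.update (tapes i o c l t b h x d T) (Sum.inl Stk.tmp) a =
    tapes i o c l a b h x d T := by
  funext k; rcases k with (_ | _) | _ <;> rfl

@[simp] theorem update_blocks :
    Function.update (tapes i o c l t b h x d T) (Sum.inl Stk.blocks) a =
      tapes i o c l t a h x d T := by
  funext k; rcases k with (_ | _) | _ <;> rfl

@[simp] theorem update_half : Function.update (tapes i o c l t b h x d T) (Sum.inl Stk.half) a =
    tapes i o c l t b a x d T := by
  funext k; rcases k with (_ | _) | _ <;> rfl

@[simp] theorem update_idx : Function.update (tapes i o c l t b h x d T) (Sum.inl Stk.idx) a =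
    tapes i o c l t b h a d T := by
  funext k; rcases k with (_ | _) | _ <;> rfl

@[simp] theorem update_dbl : Function.update (tapes i o c l t b h x d T) (Sum.inl Stk.dbl) a =
    tapes i o c l t b h x a T := by
  funext k; rcases k with (_ | _) | _ <;> rfl

@[simp] theorem update_sub (k : M.K) (s : List (M.Γ k)) :
    Function.update (tapes i o c l t b h x d T) (Sum.inr k) s =
      tapes i o c l t b h x d (Function.update T k s) := by
  funext k'
  rcases k' with (_ | _) | k' <;> try rfl
  by_cases hk : k' = k
  · subst hk
    simp [tapes]
  · rw [Function.update_of_ne (by simpa using hk)]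
    simp [tapes, Function.update_of_ne hk]

end tapes

variable {one : M.Γ M.k₀} {rec : Bool}

/-- Configurations. -/
abbrev Conf (M : FinTM2) : Type := TM2.Cfg (Alph M) (Lbl ⊕ M.Λ) (Reg M.σ)

/-- `Reach one rec k a b`: the program gets from `a` to `b` in at most `k` steps. -/
def Reach (one : M.Γ M.k₀) (rec : Bool) (k : ℕ) (a b : Conf M) : Prop :=
  ∃ j ≤ k, (flip bind (TM2.step (program one rec)))^[j] (some a) = some b

theorem Reach.refl (k : ℕ) (a : Conf M) : Reach one rec k a a := ⟨0, Nat.zero_le _, rfl⟩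

theorem Reach.mono {k k' : ℕ} {a b : Conf M} (h : Reach one rec k a b) (hk : k ≤ k') :
    Reach one rec k' a b := by
  obtain ⟨j, hj, h⟩ := h
  exact ⟨j, hj.trans hk, h⟩

theorem Reach.trans {k k' : ℕ} {a b c : Conf M} (h : Reach one rec k a b)
    (h' : Reach one rec k' b c) : Reach one rec (k + k') a c := by
  obtain ⟨j, hj, h⟩ := h
  obtain ⟨j', hj', h'⟩ := h'
  refine ⟨j' + j, by omega, ?_⟩
  rw [Function.iterate_add_apply, h, h']

theorem Reach.step {k : ℕ} {a b c : Conf M} (h : TM2.step (program one rec) a = some b)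
    (h' : Reach one rec k b c) : Reach one rec (k + 1) a c := by
  have h₁ : Reach one rec 1 a b := ⟨1, le_rfl, h⟩
  exact (h₁.trans h').mono (by omega)

end ParamGames

namespace ParamGames

open Turing

variable {M : FinTM2} {one : M.Γ M.k₀} {rec : Bool}

attribute [simp] program Prog.pop Prog.push Prog.pushTop Prog.ifEmpty Prog.ifTop Prog.setMode
  Prog.setFlag Prog.setBit Prog.ifMode Prog.ifBit Prog.go readSym writeSym tapes

/-- A list of `n` ticks. -/
abbrev ticks (n : ℕ) : List Sym := List.replicate n Sym.tick

theorem ticks_append_cons (n : ℕ) (l : List Sym) :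
    ticks n ++ Sym.tick :: l = ticks (n + 1) ++ l := by
  rw [ticks, ticks, List.replicate_succ', List.append_assoc]
  rfl

/-! ### Running the subroutine -/

/-- The unary security parameter is handed over to the subroutine. -/
theorem reach_ticks (n : ℕ) (v : Reg M.σ) (i : List (Option Sym)) (o c l t b h x d : List Sym)
    (m : ℕ) :
    Reach one rec (n + 1)
      ⟨some (Sum.inl .ticks), v, tapes (List.replicate n (some .tick) ++ none :: i) o c l t b h x d
        (Function.update (fun _ => []) M.k₀ (List.replicate m one))⟩
      ⟨some (Sum.inr M.main), { v with top := some none }, tapes i o c l t b h x d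
        (Function.update (fun _ => []) M.k₀ (List.replicate (m + n) one))⟩ := by
  induction n generalizing v m with
  | zero =>
    refine Reach.step ?_ (Reach.refl _ _)
    simp
  | succ n ih =>
    refine Reach.step (b := ⟨some (Sum.inl .ticks), { v with top := some (some .tick) },
      tapes (List.replicate n (some .tick) ++ none :: i) o c l t b h x d
        (Function.update (fun _ => []) M.k₀ (List.replicate (m + 1) one))⟩) ?_ ?_
    · simp [List.replicate_succ]
    · have := ih { v with top := some (some .tick) } (m + 1)
      rwa [show m + 1 + n = m + (n + 1) by omega] at this

/-- The configuration of the machine that corresponds to one of the subroutine. -/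
def liftConf (v : Reg M.σ) (i : List (Option Sym)) (a : M.Cfg) : Conf M :=
  ⟨some (a.l.elim (Sum.inl .init) Sum.inr), { v with sub := a.var },
    tapes i [] [] [] [] [] [] [] [] a.stk⟩

theorem stepAux_ofSub (v : Reg M.σ) (i : List (Option Sym)) (P : TM2.Stmt M.Γ M.Λ M.σ) (s : M.σ)
    (T : ∀ k, List (M.Γ k)) :
    TM2.stepAux (Prog.ofSub P) { v with sub := s } (tapes i [] [] [] [] [] [] [] [] T) =
      liftConf v i (TM2.stepAux P s T) := by
  induction P generalizing s T with
  | push k f P ih => simp [Prog.ofSub, ← ih]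
  | peek k f P ih => simp [Prog.ofSub, ← ih]
  | pop k f P ih => simp [Prog.ofSub, ← ih]
  | load f P ih => simp [Prog.ofSub, ← ih]
  | branch f P Q ih₁ ih₂ =>
    cases hb : f s <;> simp [Prog.ofSub, hb, ih₁, ih₂]
  | goto f => rfl
  | halt => rfl

theorem iterate_none {α : Type} (f : α → Option α) (j : ℕ) : (flip bind f)^[j] none = none := by
  induction j with
  | zero => rfl
  | succ j ih => rw [Function.iterate_succ_apply]; exact ih

/-- The machine simulates the subroutine step by step. -/
theorem reach_sub (v : Reg M.σ) (i : List (Option Sym)) (j : ℕ) (a b : M.Cfg)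
    (h : (flip bind M.step)^[j] (some a) = some b) :
    Reach one rec j (liftConf v i a) (liftConf v i b) := by
  induction j generalizing a with
  | zero =>
    obtain rfl : a = b := Option.some.inj h
    exact Reach.refl _ _
  | succ j ih =>
    rw [Function.iterate_succ_apply] at h
    obtain ⟨l, s, T⟩ := a
    rcases l with _ | l
    · have : flip bind M.step (some ⟨none, s, T⟩) = none := rfl
      rw [this, iterate_none] at h
      exact absurd h (by simp)
    · refine Reach.step (b := liftConf v i (TM2.stepAux (M.m l) s T)) ?_ (ih _ h)
      rw [← stepAux_ofSub]
      rfl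

/-! ### Loops -/

/-- Configurations in which the stacks of the subroutine are empty. -/
abbrev conf (q : Lbl) (top : Option (Option Sym)) (md : Mode) (fl bt mr : Bool)
    (i : List (Option Sym)) (o c l t b h x d : List Sym) : Conf M :=
  ⟨some (Sum.inl q), ⟨top, md, fl, bt, mr, M.initialState⟩, tapes i o c l t b h x d fun _ => []⟩

variable {top : Option (Option Sym)} {md : Mode} {fl bt mr : Bool} {i : List (Option Sym)}
  {o c l t b h x d : List Sym}

/-- The output of the subroutine is turned into empty cells and a counter for the blocks. -/
theorem reach_init (n : ℕ) (one' : M.Γ M.k₁) (m : ℕ) :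
    Reach one rec (n + 1)
      ⟨some (Sum.inl .init), ⟨top, md, fl, bt, mr, M.initialState⟩,
        tapes i o c (List.replicate m .bot) t (ticks m) h x d
          (Function.update (fun _ => []) M.k₁ (List.replicate n one'))⟩
      (conf .move none md fl bt mr i o c (List.replicate (m + n) .bot) t (ticks (m + n)) h x
        d) := by
  induction n generalizing top m with
  | zero =>
    refine Reach.step ?_ (Reach.refl _ _)
    simp
  | succ n ih =>
    refine Reach.step (b := ⟨some (Sum.inl .init), ⟨some none, md, fl, bt, mr, M.initialState⟩,
        tapes i o c (List.replicate (m + 1) .bot) t (ticks (m + 1)) h x d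
          (Function.update (fun _ => []) M.k₁ (List.replicate n one'))⟩) ?_ ?_
    · simp [List.replicate_succ]
    · have := ih (top := some none) (m + 1)
      rwa [show m + 1 + n = m + (n + 1) by omega] at this

theorem reach_clearThr :
    Reach one rec (c.length + 1) (conf .clearThr top md fl bt mr i o c l t b h x d)
      (conf .readThr none md fl bt mr i o [] l t b h x d) := by
  induction c generalizing top with
  | nil => exact Reach.step (by simp) (Reach.refl _ _)
  | cons a c ih => exact Reach.step (by simp; rfl) ih

theorem reach_readThr (j m : ℕ) :
    Reach one rec j
      (conf .readThr top md fl bt mr (List.replicate j (some .tick) ++ i) o (ticks m) l t b h x d)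
      (conf .readThr (if j = 0 then top else some (some .tick)) md fl bt mr i o (ticks (m + j))
        l t b h x d) := by
  induction j generalizing top m with
  | zero => exact Reach.refl _ _
  | succ j ih =>
    refine Reach.step (b := conf .readThr (some (some .tick)) md fl bt mr
      (List.replicate j (some .tick) ++ i) o (ticks (m + 1)) l t b h x d) ?_ ?_
    · simp [List.replicate_succ]
    · have := ih (top := some (some .tick)) (m + 1)
      rw [show m + 1 + j = m + (j + 1) by omega, ite_self] at this
      simpa using this

theorem reach_readAnswer (w : List Bool) :
    Reach one rec (w.length + 1)
      (conf .readAnswer top md fl bt mr ((w.map Sym.bit).map some ++ none :: i) o c l t b h x d)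
      (conf .move (some none) md (fl || !w.isEmpty) bt mr i o c l t b h x d) := by
  induction w generalizing top fl with
  | nil => exact Reach.step (by simp) (Reach.refl _ _)
  | cons a w ih =>
    refine Reach.step (by simp; rfl) ?_
    simpa using ih (fl := true)

theorem reach_halve : ∀ (r m : ℕ) (top : Option (Option Sym)),
    Reach one rec (r / 2 + 1) (conf .halve top md fl bt mr i o c l t (ticks r) (ticks m) x d)
      (conf .unhalve none md fl bt mr i o c l t [] (ticks (m + r / 2)) x d)
  | 0, m, top => Reach.step (by simp) (Reach.refl _ _)
  | 1, m, top => Reach.step (by simp) (Reach.refl _ _)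
  | r + 2, m, top => by
    rw [show (r + 2) / 2 = r / 2 + 1 by omega]
    refine Reach.step (b := conf .halve (some (some .tick)) md fl bt mr i o c l t (ticks r)
      (ticks (m + 1)) x d) ?_ ?_
    · simp [List.replicate_succ]
    · have := reach_halve r (m + 1) (some (some .tick))
      rwa [show m + 1 + r / 2 = m + (r / 2 + 1) by omega] at this

theorem reach_unhalve (r m : ℕ) :
    Reach one rec (r + 1) (conf .unhalve top md fl bt mr i o c l t (ticks m) (ticks r) x d)
      (conf .double none md fl bt mr i o c l t (ticks (m + r)) [] x d) := by
  induction r generalizing top m with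
  | zero => exact Reach.step (by simp) (Reach.refl _ _)
  | succ r ih =>
    refine Reach.step (b := conf .unhalve (some (some .tick)) md fl bt mr i o c l t (ticks (m + 1))
      (ticks r) x d) ?_ ?_
    · simp [List.replicate_succ]
    · have := ih (top := some (some .tick)) (m + 1)
      rwa [show m + 1 + r = m + (r + 1) by omega] at this

theorem reach_double (r m : ℕ) :
    Reach one rec (r + 1) (conf .double top md fl bt mr i o c l t b h (ticks r) (ticks m))
      (conf .undouble none md fl bt mr i o c l t b h [] (ticks (m + 2 * r))) := by
  induction r generalizing top m with
  | zero => exact Reach.step (by simp) (Reach.refl _ _)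
  | succ r ih =>
    refine Reach.step (b := conf .double (some (some .tick)) md fl bt mr i o c l t b h (ticks r)
      (ticks (m + 2))) ?_ ?_
    · simp [List.replicate_succ]
    · have := ih (top := some (some .tick)) (m + 2)
      rwa [show m + 2 + 2 * r = m + 2 * (r + 1) by omega] at this

theorem reach_undouble (r m : ℕ) :
    Reach one rec (r + 1) (conf .undouble top md fl bt mr i o c l t b h (ticks m) (ticks r))
      (conf .readArg none md fl bt mr i o c l t b h (ticks (m + r + bt.toNat)) []) := by
  induction r generalizing top m with
  | zero =>
    cases bt
    · exact Reach.step (by simp) (Reach.refl _ _)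
    · exact Reach.step (b := conf .readArg none md fl true mr i o c l t b h (ticks (m + 0 + 1)) [])
        (by simp [List.replicate_succ]) (Reach.refl _ _)
  | succ r ih =>
    refine Reach.step (b := conf .undouble (some (some .tick)) md fl bt mr i o c l t b h
      (ticks (m + 1)) (ticks r)) ?_ ?_
    · simp [List.replicate_succ]
    · have := ih (top := some (some .tick)) (m + 1)
      rwa [show m + 1 + r = m + (r + 1) by omega] at this

/-- One step of the computation in `blockIdx`. -/
theorem reach_readArg_bit (a : Bool) (r y : ℕ) :
    ∃ top' bt', Reach one rec (r + 3 * y + 5)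
      (conf .readArg top md fl bt mr (some (.bit a) :: i) o c l t (ticks r) [] (ticks y) [])
      (conf .readArg top' md fl bt' mr i o c l t
        (ticks (blockStep (r, y) a).1) [] (ticks (blockStep (r, y) a).2) []) := by
  rcases r with _ | _ | r
  · refine ⟨none, a, Reach.mono (Reach.step ?_ (Reach.refl 0 _)) (by omega)⟩
    cases a <;> simp [blockStep]
  · refine ⟨none, a, Reach.mono (Reach.step ?_ (Reach.refl 0 _)) (by omega)⟩
    cases a <;> simp [blockStep]
  · refine ⟨none, a, ?_⟩
    rw [blockStep, if_pos (by omega)]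
    have h₁ : Reach one rec 1
        (conf .readArg top md fl bt mr (some (.bit a) :: i) o c l t (ticks (r + 2)) [] (ticks y) [])
        (conf .halve (some (some .tick)) md fl a mr i o c l t (ticks (r + 2)) [] (ticks y) []) :=
      Reach.step (by cases a <;> simp [List.replicate_succ]) (Reach.refl _ _)
    have h₂ := reach_halve (one := one) (rec := rec) (md := md) (fl := fl) (bt := a) (mr := mr)
      (i := i) (o := o) (c := c) (l := l) (t := t) (x := ticks y) (d := []) (r + 2) 0
      (some (some .tick))
    have h₃ := reach_unhalve (one := one) (rec := rec) (top := none) (md := md) (fl := fl) (bt := a)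
      (mr := mr) (i := i) (o := o) (c := c) (l := l) (t := t) (x := ticks y) (d := [])
      ((r + 2) / 2) 0
    have h₄ := reach_double (one := one) (rec := rec) (top := none) (md := md) (fl := fl) (bt := a)
      (mr := mr) (i := i) (o := o) (c := c) (l := l) (t := t) (b := ticks ((r + 2) / 2)) (h := [])
      y 0
    have h₅ := reach_undouble (one := one) (rec := rec) (top := none) (md := md) (fl := fl)
      (bt := a) (mr := mr) (i := i) (o := o) (c := c) (l := l) (t := t) (b := ticks ((r + 2) / 2)) (h := [])
      (2 * y) 0
    rw [Nat.zero_add] at h₂ h₃ h₄ h₅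
    exact (h₁.trans (h₂.trans (h₃.trans (h₄.trans h₅)))).mono (by omega)

/-- The block index of an argument is computed in time polynomial in `N`, because the stacks involved
never get longer than `N`. -/
theorem reach_readArg (N : ℕ) (w : List Bool) (s : ℕ × ℕ) (hs : (s.2 + 1) * s.1 ≤ N)
    (hs' : s.2 ≤ N) :
    ∃ top', Reach one rec (w.length * (4 * N + 5) + 1)
      (conf .readArg top md fl bt mr ((w.map Sym.bit).map some ++ none :: i) o c l t (ticks s.1) []
        (ticks s.2) [])
      (conf .clearBlocks top' md fl false mr i o c l t
        (ticks (w.foldl blockStep s).1) []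
        (ticks (w.foldl blockStep s).2)
        []) := by
  induction w generalizing s top bt with
  | nil => exact ⟨some none, Reach.mono (Reach.step (by simp) (Reach.refl 0 _)) (by simp)⟩
  | cons a w ih =>
    obtain ⟨r, y⟩ := s
    simp only at hs hs'
    obtain ⟨top', bt', h₁⟩ := reach_readArg_bit (one := one) (rec := rec) (top := top) (md := md)
      (fl := fl) (bt := bt) (mr := mr) (i := (w.map Sym.bit).map some ++ none :: i) (o := o)
      (c := c) (l := l) (t := t) a r y
    have hr : r ≤ N := by nlinarith
    have ha : a.toNat ≤ 1 := a.toNat_le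
    obtain ⟨top'', h₂⟩ := ih (top := top') (bt := bt') (blockStep (r, y) a)
      (blockStep_bound hs a)
      (by
        simp only [blockStep]
        split_ifs with hr2
        · have : (y + 1) * 2 ≤ N := le_trans (by gcongr) hs
          simp only
          omega
        · exact hs')
    refine ⟨top'', (h₁.trans h₂).mono ?_⟩
    rw [List.length_cons]
    have : (w.length + 1) * (4 * N + 5) = w.length * (4 * N + 5) + 4 * N + 5 := by ring
    omega

theorem reach_clearBlocks (r : ℕ) :
    Reach one rec (r + 1) (conf .clearBlocks top md fl bt mr i o c l t (ticks r) h x d)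
      (conf .mark none md fl bt mr i o c l t [] h x d) := by
  induction r generalizing top with
  | zero => exact Reach.step (by simp) (Reach.refl _ _)
  | succ r ih => exact Reach.step (by simp [List.replicate_succ]; rfl) ih

/-- Once a cell has been marked, which the bit of the state records, the others are only moved. -/
theorem reach_mark_done :
    ∃ mr', Reach one rec (l.length + 1) (conf .mark top md fl true mr i o c l t b h [] d)
      (conf .unmark none md fl true mr' i o c [] (l.reverse ++ t) b h [] d) := by
  induction l generalizing top mr t with
  | nil => exact ⟨mr, Reach.step (by simp) (Reach.refl _ _)⟩
  | cons a l ih =>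
    obtain ⟨mr', h'⟩ := ih (top := some (some a)) (mr := false) (t := a :: t)
    rw [List.reverse_cons, List.append_assoc, List.singleton_append]
    exact ⟨mr', Reach.step (by simp) h'⟩

theorem reach_mark (y : ℕ) (hy : y < l.length ∨ y = 0) :
    ∃ bt' mr', Reach one rec (l.length + 1)
      (conf .mark top md fl false mr i o c l t b h (ticks y) d)
      (conf .unmark none md fl bt' mr' i o c [] ((l.set y (.bit false)).reverse ++ t) b h []
        d) := by
  induction l generalizing top mr t y with
  | nil =>
    obtain rfl : y = 0 := by simpa using hy
    exact ⟨false, mr, Reach.step (by simp) (Reach.refl _ _)⟩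
  | cons a l ih =>
    rcases y with _ | y
    · obtain ⟨mr', h'⟩ := reach_mark_done (one := one) (rec := rec) (top := some (some a))
        (md := md) (fl := fl) (mr := false) (i := i) (o := o) (c := c) (l := l) (t := .bit false :: t) (b := b)
        (h := h) (d := d)
      rw [List.set_cons_zero, List.reverse_cons, List.append_assoc, List.singleton_append]
      exact ⟨true, mr', Reach.step (by simp) h'⟩
    · obtain ⟨bt', mr', h'⟩ := ih (top := some (some a)) (mr := true) (t := a :: t) y
        (by
          simp only [List.length_cons] at hy
          omega)
      rw [List.set_cons_succ, List.reverse_cons, List.append_assoc, List.singleton_append]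
      exact ⟨bt', mr', Reach.step (by simp [List.replicate_succ]) h'⟩

/-- The cells are put back, and the counter for the blocks, which the computation of the block index
has used up, is restored. -/
theorem reach_unmark (m : ℕ) :
    Reach one rec (t.length + 1) (conf .unmark top md fl bt mr i o c l t (ticks m) h x d)
      (conf .move none md fl bt mr i o c (t.reverse ++ l) [] (ticks (m + t.length)) h x d) := by
  induction t generalizing top l m with
  | nil => exact Reach.step (by simp) (Reach.refl _ _)
  | cons a t ih =>
    refine Reach.step (b := conf .unmark (some (some a)) md fl bt mr i o c (a :: l) t
      (ticks (m + 1)) h x d) ?_ ?_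
    · simp [List.replicate_succ]
    · have := ih (top := some (some a)) (l := a :: l) (m + 1)
      rw [show m + 1 + t.length = m + (a :: t).length by simp; omega] at this
      simpa using this

theorem reach_writeThr (j : ℕ) :
    Reach one rec (j + 1) (conf .writeThr top md fl bt mr i o (ticks j) l t b h x d)
      (conf .cleanThr none md fl bt mr i (.right :: .left :: .sep :: .left :: (ticks j ++ o))
        [] l t b h x d) := by
  induction j generalizing top o with
  | zero => exact Reach.step (by simp) (Reach.refl _ _)
  | succ j ih =>
    have := ih (top := some (some .tick)) (o := .tick :: o)
    rw [ticks_append_cons] at this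
    exact Reach.step (by simp [List.replicate_succ]) this

theorem reach_dumpCells :
    Reach one rec (l.length + 1) (conf .dumpCells top md fl bt mr i o c l t b h x d)
      (conf .writeCells none md fl bt mr i o c []
        ((if rec && fl then l else List.replicate l.length .bot).reverse ++ t) b h x d) := by
  induction l generalizing top t with
  | nil => exact Reach.step (by simp) (Reach.refl _ _)
  | cons a l ih =>
    have := ih (top := some (some a)) (t := (if rec && fl then a else .bot) :: t)
    have e : (if rec && fl then a :: l else List.replicate (a :: l).length .bot).reverse ++ t =
        (if rec && fl then l else List.replicate l.length .bot).reverse ++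
          (if rec && fl then a else .bot) :: t := by
      cases rec <;> cases fl <;> simp [List.replicate_succ]
    rw [e]
    refine Reach.step ?_ this
    cases rec <;> cases fl <;> simp

theorem reach_writeCells :
    Reach one rec (t.length + 1) (conf .writeCells top md fl bt mr i o c l t b h x d)
      (conf .cleanThr none md fl bt mr i (.right :: .right :: .ans :: (t.reverse ++ o))
        c l [] b h x d) := by
  induction t generalizing top o with
  | nil => exact Reach.step (by simp) (Reach.refl _ _)
  | cons a t ih =>
    have := ih (top := some (some a)) (o := a :: o)
    rw [List.reverse_cons, List.append_assoc, List.singleton_append]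
    exact Reach.step (by simp) this

theorem reach_cleanThr :
    Reach one rec (c.length + 1) (conf .cleanThr top md fl bt mr i o c l t b h x d)
      (conf .cleanCells none md fl bt mr i o [] l t b h x d) := by
  induction c generalizing top with
  | nil => exact Reach.step (by simp) (Reach.refl _ _)
  | cons a c ih => exact Reach.step (by simp; rfl) ih

theorem reach_cleanCells :
    Reach one rec (l.length + 1) (conf .cleanCells top md fl bt mr i o c l t b h x d)
      (conf .cleanBlocks none md fl bt mr i o c [] t b h x d) := by
  induction l generalizing top with
  | nil => exact Reach.step (by simp) (Reach.refl _ _)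
  | cons a l ih => exact Reach.step (by simp; rfl) ih

theorem reach_cleanBlocks :
    Reach one rec (b.length + 1) (conf .cleanBlocks top md fl bt mr i o c l t b h x d)
      ⟨none, Reg.start M, tapes i o c l t [] h x d fun _ => []⟩ := by
  induction b generalizing top with
  | nil => exact Reach.step (by simp) (Reach.refl _ _)
  | cons a b ih => exact Reach.step (by simp; rfl) ih

end ParamGames

namespace ParamGames

open Turing

variable {M : FinTM2} {one : M.Γ M.k₀} {rec : Bool}

/-! ### Reading the history -/

/-- The encoding of the moves of predicates. -/
abbrev predEnc : PredMove → List Sym := predGame.enc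

/-- The encoding of the moves of second-order functions. -/
abbrev sofEnc : SofMove → List Sym :=
  lolliEnc (bangEnc predEnc) (groundEnc fun w : List Bool => w.map Sym.bit)

/-- The encoding of the moves of `infGame`. -/
abbrev infEnc : InfMove → List Sym :=
  lolliEnc (groundEnc fun b : Bool => [Sym.bit b])
    (lolliEnc (bangEnc sofEnc) (groundEnc fun w : List (Option Bool) => w.map ternarySym))

/-- An encoded move with its end marker, as it appears on the input stack. -/
def block (e : List Sym) : List (Option Sym) := e.map some ++ [none]

/-- What the machine stores about the history: the kind of the last move, a thread number, whether
the final answer is nonempty, and the cells of the partial function. -/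
structure Track where
  mode : Mode
  thr : ℕ
  flag : Bool
  cells : List (Option Bool)

/-- The effect of reading a move of the second-order function. -/
def Track.read (N : ℕ) (s : Track) : SofMove → Track
  | Sum.inl (j, Sum.inl none) => { s with mode := .own, thr := j }
  | Sum.inl (j, Sum.inl (some w)) =>
    { s with mode := .argument, thr := j, cells := s.cells.set (blockIdx N w) (some false) }
  | Sum.inl (j, Sum.inr none) => { s with mode := .query, thr := j }
  | Sum.inl (j, Sum.inr (some _)) => { s with mode := .own, thr := j }
  | Sum.inr none => { s with mode := .own }
  | Sum.inr (some a) => { s with mode := .answer, flag := !a.isEmpty }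

theorem Track.length_cells_read (N : ℕ) (s : Track) (m : SofMove) :
    (s.read N m).cells.length = s.cells.length := by
  rcases m with ⟨j, (_ | w) | (_ | b)⟩ | (_ | a) <;> simp [Track.read]

theorem Track.cells_foldl_read (N : ℕ) (s : Track) (v : List SofMove) :
    (v.foldl (Track.read N) s).cells =
      (queries v).foldl (fun L w => L.set (blockIdx N w) (some false)) s.cells := by
  induction v generalizing s with
  | nil => rfl
  | cons m v ih =>
    rw [List.foldl_cons, ih]
    rcases m with ⟨j, (_ | w) | (_ | b)⟩ | (_ | a) <;> rfl

/-- The configurations in which the machine is about to read a move. -/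
abbrev Track.conf (s : Track) (N : ℕ) (top : Option (Option Sym)) (bt mr : Bool)
    (i : List (Option Sym)) : Conf M :=
  ParamGames.conf .move top s.mode s.flag bt mr i [] (ticks s.thr) (s.cells.map ternarySym) []
    (ticks N) [] [] []

/-- The second alternative only matters for `N = 0`. -/
theorem blockIdx_lt (N : ℕ) (w : List Bool) : blockIdx N w < N ∨ blockIdx N w = 0 := by
  have key : ∀ (w : List Bool) (s : ℕ × ℕ), (s.2 + 1) * s.1 ≤ N → 1 ≤ s.1 →
      (w.foldl blockStep s).2 < N := by
    intro w
    induction w with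
    | nil =>
      intro s hs h1
      have : (s.2 + 1) * 1 ≤ N := le_trans (by gcongr) hs
      simp only [List.foldl_nil]
      omega
    | cons a w ih =>
      intro s hs h1
      refine ih _ (blockStep_bound hs a) ?_
      simp only [blockStep]
      split_ifs
      · simp only
        omega
      · exact h1
  rcases Nat.eq_zero_or_pos N with rfl | hN
  · right
    have : ∀ (w : List Bool) (y : ℕ), (w.foldl blockStep (0, y)).2 = y := by
      intro w y
      induction w with
      | nil => rfl
      | cons a w ih => simpa [blockStep] using ih
    exact this w 0
  · exact Or.inl (key w (N, 0) (by simp) hN)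

/-- Reading the thread number of a move. -/
theorem reach_thr {md : Mode} {fl bt mr : Bool} {o l t b h x d : List Sym} (k j : ℕ)
    (top : Option (Option Sym)) (i : List (Option Sym)) :
    ∃ top', Reach one rec (k + j + 2)
      (conf .move top md fl bt mr (some .right :: some .left :: some .sep :: some .left ::
        (List.replicate j (some .tick) ++ i)) o (ticks k) l t b h x d)
      (conf .readThr top' md fl bt mr i o (ticks j) l t b h x d) := by
  have h₁ : Reach one rec 1 (conf .move top md fl bt mr (some .right :: some .left :: some .sep ::
        some .left :: (List.replicate j (some .tick) ++ i)) o (ticks k) l t b h x d)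
      (conf .clearThr (some (some .left)) md fl bt mr (List.replicate j (some .tick) ++ i) o
        (ticks k) l t b h x d) := Reach.step (by simp) (Reach.refl _ _)
  have h₂ := reach_clearThr (one := one) (rec := rec) (top := some (some .left)) (md := md)
    (fl := fl) (bt := bt) (mr := mr) (i := List.replicate j (some .tick) ++ i) (o := o)
    (c := ticks k) (l := l) (t := t) (b := b) (h := h) (x := x) (d := d)
  have h₃ := reach_readThr (one := one) (rec := rec) (top := none) (md := md)
    (fl := fl) (bt := bt) (mr := mr) (i := i) (o := o) (l := l) (t := t) (b := b) (h := h) (x := x)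
    (d := d) j 0
  rw [Nat.zero_add] at h₃
  exact ⟨_, (h₁.trans (h₂.trans h₃)).mono (by simp; omega)⟩

/-- Reading a move, and marking the block of its argument if it has one. -/
theorem reach_move (N ℓ : ℕ) (s : Track) (m : SofMove) (top : Option (Option Sym)) (bt mr : Bool)
    (i : List (Option Sym)) (hs : s.cells.length = N) (ht : s.thr ≤ ℓ)
    (hm : (sofEnc m).length ≤ ℓ) :
    ∃ top' bt' mr', Reach one rec ((ℓ + 1) * (4 * N + 20))
      (s.conf N top bt mr (block (infEnc (callMove m)) ++ i))
      ((s.read N m).conf N top' bt' mr' i) := by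
  have hK : ℓ * (4 * N + 5) + 15 * ℓ + 4 * N + 20 = (ℓ + 1) * (4 * N + 20) := by ring
  rcases m with ⟨j, pm⟩ | (_ | a)
  · have hj : j + (predEnc pm).length ≤ ℓ := by
      simp only [sofEnc, lolliEnc, bangEnc, List.length_cons, List.length_append,
        List.length_replicate] at hm
      omega
    have hb : block (infEnc (callMove (Sum.inl (j, pm)))) ++ i = some .right :: some .left ::
        some .sep :: some .left :: (List.replicate j (some .tick) ++
          (some .sep :: (block (predEnc pm) ++ i))) := by
      simp [block, infEnc, callMove, lolliEnc, bangEnc, sofEnc]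
    obtain ⟨top₁, h₁⟩ := reach_thr (one := one) (rec := rec) (md := s.mode) (fl := s.flag)
      (bt := bt) (mr := mr) (o := []) (l := s.cells.map ternarySym) (t := []) (b := ticks N)
      (h := []) (x := []) (d := []) s.thr j top (some .sep :: (block (predEnc pm) ++ i))
    rw [Track.conf, hb]
    rcases pm with (_ | w) | (_ | b)
    · refine ⟨some none, bt, mr, (h₁.trans (k' := 1) (Reach.step ?_ (Reach.refl 0 _))).mono ?_⟩
      · simp [block, predEnc, lolliEnc, groundEnc, Track.read]
      · omega
    · have h₂ : Reach one rec 1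
          (conf .readThr top₁ s.mode s.flag bt mr
            (some .sep :: (block (predEnc (Sum.inl (some w))) ++ i)) [] (ticks j)
            (s.cells.map ternarySym) [] (ticks N) [] [] [])
          (conf .readArg (some (some .ans)) .argument s.flag bt mr
            ((w.map Sym.bit).map some ++ none :: i) [] (ticks j)
            (s.cells.map ternarySym) [] (ticks N) [] [] []) :=
        Reach.step (by simp [block, predEnc, lolliEnc, groundEnc]) (Reach.refl _ _)
      obtain ⟨top₃, h₃⟩ := reach_readArg (one := one) (rec := rec) (top := some (some .ans))
        (md := .argument) (fl := s.flag) (bt := bt) (mr := mr) (i := i) (o := []) (c := ticks j)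
        (l := s.cells.map ternarySym) (t := []) N w (N, 0) (by simp) (by simp)
      have hr : (w.foldl blockStep
          (N, 0)).1 ≤ N := by
        have : ∀ (w : List Bool) (s : ℕ × ℕ),
            (w.foldl blockStep s).1 ≤
              s.1 := by
          intro w
          induction w with
          | nil => intro s; exact le_rfl
          | cons a w ih =>
            intro s
            refine (ih _).trans ?_
            unfold blockStep
            split_ifs
            · exact Nat.div_le_self _ _
            · exact le_rfl
        exact this w (N, 0)
      have h₄ := reach_clearBlocks (one := one) (rec := rec) (top := top₃) (md := .argument)
        (fl := s.flag) (bt := false) (mr := mr) (i := i) (o := []) (c := ticks j)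
        (l := s.cells.map ternarySym) (t := []) (h := []) (x := ticks (blockIdx N w)) (d := [])
        (w.foldl blockStep (N, 0)).1
      obtain ⟨bt₅, mr₅, h₅⟩ := reach_mark (one := one) (rec := rec) (top := none) (md := .argument)
        (fl := s.flag) (mr := mr) (i := i) (o := []) (c := ticks j)
        (l := s.cells.map ternarySym) (t := []) (b := []) (h := []) (d := []) (blockIdx N w)
        (by rw [List.length_map, hs]; exact blockIdx_lt N w)
      have h₆ := reach_unmark (one := one) (rec := rec) (top := none) (md := .argument)
        (fl := s.flag) (bt := bt₅) (mr := mr₅) (i := i) (o := []) (c := ticks j) (l := [])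
        (t := ((s.cells.map ternarySym).set (blockIdx N w) (.bit false)).reverse ++ []) (h := [])
        (x := []) (d := []) 0
      have e :
          (((s.cells.map ternarySym).set (blockIdx N w) (.bit false)).reverse ++ []).reverse ++ [] =
            (s.cells.set (blockIdx N w) (some false)).map ternarySym := by
        rw [List.map_set]
        simp [ternarySym]
      have e' :
          0 + (((s.cells.map ternarySym).set (blockIdx N w) (.bit false)).reverse ++ []).length =
            N := by
        simp [hs]
      rw [e, e'] at h₆
      refine ⟨none, bt₅, mr₅, (h₁.trans (h₂.trans (h₃.trans (h₄.trans (h₅.trans h₆))))).mono ?_⟩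
      have hw : w.length * (4 * N + 5) ≤ ℓ * (4 * N + 5) := by
        refine Nat.mul_le_mul_right _ ?_
        simp [predEnc, lolliEnc, groundEnc] at hj
        omega
      simp only [List.length_append, List.length_reverse, List.length_set, List.length_map, hs,
        List.length_nil]
      omega
    · refine ⟨some none, bt, mr, (h₁.trans (k' := 1) (Reach.step ?_ (Reach.refl 0 _))).mono ?_⟩
      · simp [block, predEnc, lolliEnc, groundEnc, Track.read]
      · omega
    · refine ⟨some none, bt, mr, (h₁.trans (k' := 1) (Reach.step ?_ (Reach.refl 0 _))).mono ?_⟩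
      · simp [block, predEnc, lolliEnc, groundEnc, Track.read]
      · omega
  · refine ⟨some none, bt, mr, Reach.mono (Reach.step ?_ (Reach.refl 0 _)) ?_⟩
    · simp [block, infEnc, callMove, lolliEnc, bangEnc, sofEnc, groundEnc, Track.read]
    · omega
  · have ha : a.length ≤ ℓ := by
      simp [sofEnc, lolliEnc, groundEnc] at hm
      omega
    have h₁ : Reach one rec 1
        (s.conf N top bt mr (block (infEnc (callMove (Sum.inr (some a)))) ++ i))
        (conf .readAnswer (some (some .ans)) .answer false bt mr
          ((a.map Sym.bit).map some ++ none :: i) [] (ticks s.thr)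
          (s.cells.map ternarySym) [] (ticks N) [] [] []) :=
      Reach.step (by simp [block, infEnc, callMove, lolliEnc, bangEnc, sofEnc, groundEnc])
        (Reach.refl _ _)
    have h₂ := reach_readAnswer (one := one) (rec := rec) (top := some (some .ans)) (md := .answer)
      (fl := false) (bt := bt) (mr := mr) (i := i) (o := []) (c := ticks s.thr)
      (l := s.cells.map ternarySym) (t := []) (b := ticks N) (h := []) (x := []) (d := []) a
    exact ⟨some none, bt, mr, (h₁.trans h₂).mono (by omega)⟩

theorem Track.thr_read_le {N ℓ : ℕ} {s : Track} {m : SofMove} (hs : s.thr ≤ ℓ)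
    (hm : (sofEnc m).length ≤ ℓ) : (s.read N m).thr ≤ ℓ := by
  rcases m with ⟨j, (_ | w) | (_ | b)⟩ | (_ | a) <;>
    simp [sofEnc, lolliEnc, bangEnc] at hm <;> simp only [Track.read] <;> omega

theorem reach_moves (N ℓ : ℕ) (v : List SofMove) (hv : ∀ m ∈ v, (sofEnc m).length ≤ ℓ) (s : Track)
    (top : Option (Option Sym)) (bt mr : Bool) (i : List (Option Sym)) (hs : s.cells.length = N)
    (ht : s.thr ≤ ℓ) :
    ∃ top' bt' mr', Reach one rec (v.length * ((ℓ + 1) * (4 * N + 20)))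
      (s.conf N top bt mr (v.flatMap (fun m => block (infEnc (callMove m))) ++ i))
      ((v.foldl (Track.read N) s).conf N top' bt' mr' i) ∧ (v.foldl (Track.read N) s).thr ≤ ℓ ∧
        (v.foldl (Track.read N) s).cells.length = N := by
  induction v generalizing s top bt mr with
  | nil => exact ⟨top, bt, mr, Reach.refl _ _, ht, hs⟩
  | cons m v ih =>
    have hm := hv m List.mem_cons_self
    obtain ⟨top₁, bt₁, mr₁, h₁⟩ := reach_move (one := one) (rec := rec) N ℓ s m top bt mr
      (v.flatMap (fun m => block (infEnc (callMove m))) ++ i) hs ht hm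
    obtain ⟨top₂, bt₂, mr₂, h₂, h₃⟩ := ih (fun m hm => hv m (List.mem_cons_of_mem _ hm))
      (s.read N m) top₁ bt₁ mr₁ (by rw [Track.length_cells_read, hs]) (Track.thr_read_le ht hm)
    refine ⟨top₂, bt₂, mr₂, ?_, h₃⟩
    rw [List.flatMap_cons, List.append_assoc, List.length_cons, add_mul, one_mul, add_comm]
    exact h₁.trans h₂

/-! ### Writing the reply -/

/-- What the machine writes in the end. -/
def Track.output (rec : Bool) (s : Track) : List Sym :=
  match s.mode with
  | .opening => [.right, .left, .sep, .right, .ask]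
  | .query => .right :: .left :: .sep :: .left :: (ticks s.thr ++ [.sep, .left, .ask])
  | .argument =>
    .right :: .left :: .sep :: .left :: (ticks s.thr ++ [.sep, .right, .ans, .bit false])
  | _ => .right :: .right :: .ans ::
    (if rec && s.flag then s.cells.map ternarySym else List.replicate s.cells.length .bot)

theorem reach_clean {top : Option (Option Sym)} {md : Mode} {fl bt mr : Bool}
    {o c l b : List Sym} :
    Reach one rec (c.length + l.length + b.length + 3)
      (conf .cleanThr top md fl bt mr [] o c l [] b [] [] [])
      ⟨none, Reg.start M, tapes [] o [] [] [] [] [] [] [] fun _ => []⟩ :=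
  (reach_cleanThr.trans (reach_cleanCells.trans reach_cleanBlocks)).mono (by omega)

theorem reach_finish (N : ℕ) (s : Track) (top : Option (Option Sym)) (bt mr : Bool)
    (hs : s.cells.length = N) :
    Reach one rec (2 * s.thr + 4 * N + 10) (s.conf N top bt mr [])
      ⟨none, Reg.start M, tapes [] (s.output rec) [] [] [] [] [] [] [] fun _ => []⟩ := by
  have h₁ : Reach one rec 1 (s.conf N top bt mr []) (conf .finish none s.mode s.flag bt mr [] []
      (ticks s.thr) (s.cells.map ternarySym) [] (ticks N) [] [] []) :=
    Reach.step (by simp) (Reach.refl _ _)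
  have dump : s.mode = .answer ∨ s.mode = .own →
      Reach one rec (2 * s.thr + 4 * N + 10) (s.conf N top bt mr [])
        ⟨none, Reg.start M, tapes [] (.right :: .right :: .ans ::
          (if rec && s.flag then s.cells.map ternarySym else List.replicate s.cells.length .bot))
          [] [] [] [] [] [] [] fun _ => []⟩ := by
    intro hmode
    have h₂ : Reach one rec 1
        (conf .finish none s.mode s.flag bt mr [] []
          (ticks s.thr) (s.cells.map ternarySym) [] (ticks N) [] [] [])
        (conf .dumpCells none s.mode s.flag bt mr [] []
          (ticks s.thr) (s.cells.map ternarySym) [] (ticks N) [] [] []) := by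
      rcases hmode with h | h <;> exact Reach.step (by simp [h]) (Reach.refl _ _)
    have h₃ := reach_dumpCells (one := one) (rec := rec) (top := none) (md := s.mode) (fl := s.flag)
      (bt := bt) (mr := mr) (i := []) (o := []) (c := ticks s.thr) (l := s.cells.map ternarySym)
      (t := []) (b := ticks N) (h := []) (x := []) (d := [])
    have h₄ := reach_writeCells (one := one) (rec := rec) (top := none) (md := s.mode)
      (fl := s.flag) (bt := bt) (mr := mr) (i := []) (o := []) (c := ticks s.thr) (l := [])
      (t := (if rec && s.flag then s.cells.map ternarySym else
        List.replicate (s.cells.map ternarySym).length .bot).reverse ++ []) (b := ticks N) (h := [])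
      (x := []) (d := [])
    have e : ((if rec && s.flag then s.cells.map ternarySym else
        List.replicate (s.cells.map ternarySym).length .bot).reverse ++ []).reverse ++ [] =
        if rec && s.flag then s.cells.map ternarySym else List.replicate s.cells.length .bot := by
      simp
    have e' : ((if rec && s.flag then s.cells.map ternarySym else
        List.replicate (s.cells.map ternarySym).length .bot).reverse ++ []).length = N := by
      rw [List.append_nil, List.length_reverse]
      split_ifs <;> simp [hs]
    rw [e, e'] at h₄
    refine (h₁.trans (h₂.trans (h₃.trans (h₄.trans reach_clean)))).mono ?_
    simp [hs]
    omega
  have thr : ∀ o, Reach one rec 1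
        (conf .finish none s.mode s.flag bt mr [] []
          (ticks s.thr) (s.cells.map ternarySym) [] (ticks N) [] [] [])
        (conf .writeThr none s.mode s.flag bt mr [] o
          (ticks s.thr) (s.cells.map ternarySym) [] (ticks N) [] [] []) →
      Reach one rec (2 * s.thr + 4 * N + 10) (s.conf N top bt mr [])
        ⟨none, Reg.start M, tapes [] (.right :: .left :: .sep :: .left :: (ticks s.thr ++ o))
          [] [] [] [] [] [] [] fun _ => []⟩ := by
    intro o h₂
    refine (h₁.trans (h₂.trans ((reach_writeThr s.thr).trans reach_clean))).mono ?_
    simp [hs]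
    omega
  rcases hm : s.mode with _ | _ | _ | _ | _
  · have e : s.output rec = [.right, .left, .sep, .right, .ask] := by simp only [Track.output, hm]
    have h₂ : Reach one rec 1
        (conf .finish none s.mode s.flag bt mr [] []
          (ticks s.thr) (s.cells.map ternarySym) [] (ticks N) [] [] [])
        (conf .cleanThr none s.mode s.flag bt mr [] [.right, .left, .sep, .right, .ask]
          (ticks s.thr) (s.cells.map ternarySym) [] (ticks N) [] [] []) :=
      Reach.step (by simp [hm]) (Reach.refl _ _)
    rw [e]
    refine (h₁.trans (h₂.trans reach_clean)).mono ?_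
    simp [hs]
    omega
  · have e := dump (Or.inr hm)
    simpa only [Track.output, hm] using e
  · have e := thr [.sep, .left, .ask] (Reach.step (by simp [hm]) (Reach.refl _ _))
    simpa only [Track.output, hm] using e
  · have e := thr [.sep, .right, .ans, .bit false] (Reach.step (by simp [hm]) (Reach.refl _ _))
    simpa only [Track.output, hm] using e
  · have e := dump (Or.inl hm)
    simpa only [Track.output, hm] using e

/-! ### Polynomial time -/

/-- The machine writes the reply of the strategy. -/
theorem output_eq_infReply {q p : Pol} {n : ℕ} (rec : Bool) (N : ℕ) {v : List SofMove}
    (hv : Pending q p n v) :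
    (v.foldl (Track.read N) ⟨.opening, 0, false, List.replicate N none⟩).output rec =
      infEnc (infReply rec N v) := by
  rcases List.eq_nil_or_concat v with rfl | ⟨u, m, rfl⟩
  · rfl
  rw [List.concat_eq_append] at *
  have hc := Track.cells_foldl_read N ⟨.opening, 0, false, List.replicate N none⟩ (u ++ [m])
  rw [List.foldl_append, List.foldl_cons, List.foldl_nil] at hc ⊢
  unfold infReply
  rcases hx : sofReply (fun _ => false) (u ++ [m]) with _ | x
  · obtain ⟨u', a, hu, -⟩ := sof_answered hv.1 hv.2.1 hx
    obtain ⟨rfl, hm⟩ := List.append_inj' hu rfl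
    simp only [List.cons.injEq, and_true] at hm
    subst hm
    have ha : finalAnswer (u ++ [Sum.inr (some a)]) = a := by simp [finalAnswer]
    have hl : (u.foldl (Track.read N)
        ⟨.opening, 0, false, List.replicate N none⟩).cells.length = N := by
      rw [Track.cells_foldl_read, length_foldl_set, List.length_replicate]
    have ho : ∀ s : Track, s.cells.length = N → (s.read N (Sum.inr (some a))).output rec =
        .right :: .right :: .ans :: (if rec && !a.isEmpty then
          (s.read N (Sum.inr (some a))).cells.map ternarySym else List.replicate N .bot) := by
      intro s hs
      simp only [Track.read, Track.output, hs]
    rw [ho _ hl, hc]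
    simp only [outMove, infEnc, lolliEnc, groundEnc, certificate, ha, markBlocks]
    split_ifs <;> simp [ternarySym]
  · rw [sofReply_append_singleton] at hx
    rcases m with ⟨j, (_ | w) | (_ | b)⟩ | m <;> simp only [replyTo, Option.some.injEq,
      reduceCtorEq] at hx
    · subst hx
      simp [Track.read, Track.output, callMove, infEnc, sofEnc, lolliEnc, bangEnc, predEnc,
        groundEnc]
    · subst hx
      simp [Track.read, Track.output, callMove, infEnc, sofEnc, lolliEnc, bangEnc, predEnc,
        groundEnc]

theorem encInput_wrap (q p t : Pol) (n : ℕ) (v : List SofMove) :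
    (infGame q p t).encInput n (wrap v) = List.replicate n (some .tick) ++ none ::
      (block [.right, .right, .ask] ++ v.flatMap fun m => block (infEnc (callMove m))) := by
  unfold Game.encInput wrap
  rw [List.flatMap_cons, List.flatMap_map]
  rfl

theorem eval_le_eval (P : Polynomial ℕ) {a b : ℕ} (h : a ≤ b) : P.eval a ≤ P.eval b := by
  rw [Polynomial.eval_eq_sum_range, Polynomial.eval_eq_sum_range]
  gcongr

theorem unaryEncodeNat_eq_replicate (n : ℕ) :
    Computability.unaryEncodeNat n = List.replicate n true := by
  induction n with
  | zero => rfl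
  | succ n ih => rw [Computability.unaryEncodeNat, ih, List.replicate_succ]

theorem initList_eq (M : FinTM2) (s : List (M.Γ M.k₀)) :
    initList M s =
      ⟨some M.main, M.initialState, Function.update (fun _ => []) M.k₀ s⟩ := by
  unfold initList
  congr 1
  funext k
  by_cases h : k = M.k₀
  · subst h
    simp
  · simp [h]

theorem haltList_eq (M : FinTM2) (s : List (M.Γ M.k₁)) :
    haltList M s = ⟨none, M.initialState, Function.update (fun _ => []) M.k₁ s⟩ := by
  unfold haltList
  congr 1
  funext k
  by_cases h : k = M.k₁
  · subst h
    simp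
  · simp [h]

/-- The machine, run on a history in which it is the strategy's turn. -/
theorem reach_run {t : Pol}
    (hM : TM2ComputableInPolyTime Computability.unaryEncodeNat Computability.unaryEncodeNat t.toFun)
    (q p : Pol) (rec : Bool) (n ℓ : ℕ) (v : List SofMove) (hv : Pending q p n v)
    (hℓ : ((infGame q p t).encInput n (wrap v)).length = ℓ) :
    Reach (M := hM.tm) (hM.inputAlphabet.invFun true) rec
      (n + 1 + (hM.time.eval n + (t n + 1 + (1 + (v.length * ((ℓ + 1) * (4 * t n + 20)) +
        (2 * ℓ + 4 * t n + 10))))))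
      ⟨some (Sum.inl .ticks), Reg.start hM.tm,
        tapes ((infGame q p t).encInput n (wrap v)) [] [] [] [] [] [] [] [] fun _ => []⟩
      ⟨none, Reg.start hM.tm,
        tapes [] (infEnc (infReply rec (t n) v)) [] [] [] [] [] [] [] fun _ => []⟩ := by
  have hm : ∀ m ∈ v, (sofEnc m).length ≤ ℓ := by
    intro m hm
    rw [← hℓ, encInput_wrap]
    have h₁ := (List.sublist_flatten_of_mem
      (List.mem_map_of_mem (f := fun m => block (infEnc (callMove m))) hm)).length_le
    simp only [List.flatMap_def, List.length_append, List.length_cons]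
    simp only [block, callMove, infEnc, lolliEnc, bangEnc, List.length_append, List.length_cons,
      List.length_map, List.length_replicate] at h₁
    simp only [block, callMove, infEnc, lolliEnc, bangEnc, List.length_append, List.length_cons,
      List.length_map, List.length_replicate]
    omega
  rw [encInput_wrap]
  set i := v.flatMap fun m => block (infEnc (callMove m)) with hi
  have h₁ := reach_ticks (M := hM.tm) (one := hM.inputAlphabet.invFun true) (rec := rec) n
    (Reg.start hM.tm) (block [.right, .right, .ask] ++ i) [] [] [] [] [] [] [] [] 0
  have hsub := hM.outputsFun n
  have h₂ := (reach_sub (one := hM.inputAlphabet.invFun true) (rec := rec)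
    { Reg.start hM.tm with top := some none }
    (block [.right, .right, .ask] ++ i) hsub.steps _ _ hsub.evals_in_steps).mono hsub.steps_le_m
  rw [initList_eq, haltList_eq] at h₂
  simp only [unaryEncodeNat_eq_replicate, List.map_replicate, List.length_replicate] at h₂
  have h₃ := reach_init (M := hM.tm) (one := hM.inputAlphabet.invFun true) (rec := rec)
    (top := some none) (md := .own) (fl := false) (bt := false) (mr := false)
    (i := block [.right, .right, .ask] ++ i) (o := []) (c := []) (t := []) (h := []) (x := [])
    (d := []) (t n) (hM.outputAlphabet.invFun true) 0
  have h₄ : Reach (M := hM.tm) (hM.inputAlphabet.invFun true) rec 1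
      (conf .move none .own false false false (block [.right, .right, .ask] ++ i) [] []
        (List.replicate (t n) .bot) [] (ticks (t n)) [] [] [])
      (Track.conf ⟨.opening, 0, false, List.replicate (t n) none⟩ (t n) (some none) false false
        i) :=
    Reach.step (by simp [block, ternarySym]) (Reach.refl _ _)
  obtain ⟨top', bt', mr', h₅, hthr, hcells⟩ := reach_moves (M := hM.tm)
    (one := hM.inputAlphabet.invFun true) (rec := rec) (t n) ℓ v hm
    ⟨.opening, 0, false, List.replicate (t n) none⟩ (some none) false false [] (by simp) (by simp)
  rw [List.append_nil, ← hi] at h₅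
  have h₆ := (reach_finish (M := hM.tm) (one := hM.inputAlphabet.invFun true) (rec := rec) (t n) _
    top' bt' mr' hcells).mono (k' := 2 * ℓ + 4 * t n + 10) (by omega)
  rw [output_eq_infReply rec (t n) hv] at h₆
  rw [Nat.zero_add] at h₁ h₃
  have h₀ : Function.update (fun k => ([] : List (hM.tm.Γ k))) hM.tm.k₀
      (List.replicate 0 (hM.inputAlphabet.invFun true)) = fun _ => [] := by
    rw [List.replicate_zero, Function.update_eq_self_iff]
  rw [h₀] at h₁
  exact h₁.trans (h₂.trans (h₃.trans (h₄.trans (h₅.trans h₆))))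

theorem tapes_inp (s : List (Option Sym)) :
    (Function.update (fun _ => []) (Sum.inl Stk.inp) s : ∀ k, List (Alph M k)) =
      tapes s [] [] [] [] [] [] [] [] fun _ => [] := by
  funext k
  rcases k with (_ | _) | _ <;> rfl

theorem tapes_out (s : List Sym) :
    (Function.update (fun _ => []) (Sum.inl Stk.out) s : ∀ k, List (Alph M k)) =
      tapes [] s [] [] [] [] [] [] [] fun _ => [] := by
  funext k
  rcases k with (_ | _) | _ <;> rfl

theorem start_eq (one : M.Γ M.k₀) (rec : Bool) (s : List (Option Sym)) :
    initList (machine M one rec) (s.map (Equiv.refl (Option Sym)).invFun) =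
      ⟨some (Sum.inl .ticks), Reg.start M, tapes s [] [] [] [] [] [] [] [] fun _ => []⟩ := by
  rw [initList_eq]
  refine congrArg (TM2.Cfg.mk _ _) (Eq.trans ?_ (tapes_inp s))
  exact congrArg (Function.update (fun _ => []) (Sum.inl Stk.inp)) (List.map_id s)

theorem halt_eq (one : M.Γ M.k₀) (rec : Bool) (s : List Sym) :
    haltList (machine M one rec) (s.map (Equiv.refl Sym).invFun) =
      ⟨none, Reg.start M, tapes [] s [] [] [] [] [] [] [] fun _ => []⟩ := by
  rw [haltList_eq]
  refine congrArg (TM2.Cfg.mk _ _) (Eq.trans ?_ (tapes_out s))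
  exact congrArg (Function.update (fun _ => []) (Sum.inl Stk.out)) (List.map_id s)

/-- The time bound is that of `reach_run`, with `n`, the number of moves and the length of their
encodings all bounded by the length of the input, and `t n` by a polynomial in it. -/
theorem infvar_polytimeComputable {q p t : Pol} {rec : Bool} (ht : t.PolytimeComputable) :
    (infvar q p t rec).PolytimeComputable := by
  obtain ⟨hM⟩ := ht
  obtain ⟨P, hP⟩ := t.bound
  refine ⟨{
    tm := machine hM.tm (hM.inputAlphabet.invFun true) rec
    inputAlphabet := Equiv.refl _
    outputAlphabet := Equiv.refl _
    time := Polynomial.X + 1 + (hM.time + (P + 1 + (1 + (Polynomial.X *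
      ((Polynomial.X + 1) * (4 * P + 20)) + (2 * Polynomial.X + 4 * P + 10)))))
    outputsFun := ?_ }⟩
  rintro ⟨⟨n, s⟩, hs⟩
  refine Classical.choice ?_
  obtain ⟨v, rfl, hv⟩ := infNext_isSome.1 hs
  have hx : ((infvar q p t rec).next n (wrap v)).get hs = infReply rec (t n) v :=
    Option.get_of_eq_some _ (infNext_eq_some.2 ⟨v, rfl, hv, rfl⟩)
  obtain ⟨j, hj, h⟩ := reach_run hM q p rec n _ v hv rfl
  refine ⟨⟨⟨j, ?_⟩, ?_⟩⟩
  · refine (congrArg _ (congrArg some (start_eq _ _ _))).trans (h.trans ?_)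
    refine congrArg some ((halt_eq _ _ _).symm.trans ?_)
    rw [← hx]
    rfl
  · refine hj.trans ?_
    set ℓ := ((infGame q p t).encInput n (wrap v)).length with hℓ
    have hn : n ≤ ℓ := by
      rw [hℓ, encInput_wrap]
      simp
    have hvl : v.length ≤ ℓ := by
      rw [hℓ, encInput_wrap]
      have : v.length ≤ (v.flatMap fun m => block (infEnc (callMove m))).length := by
        rw [List.length_flatMap]
        have := List.card_nsmul_le_sum (v.map fun m => (block (infEnc (callMove m))).length) 1
          (by
            intro x hx
            obtain ⟨m, -, rfl⟩ := List.mem_map.1 hx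
            simp [block])
        simpa using this
      simp only [List.length_append, List.length_cons]
      omega
    have h₁ : t n ≤ P.eval ℓ := (hP n).trans (eval_le_eval P hn)
    have h₂ := eval_le_eval hM.time hn
    simp only [Polynomial.eval_add, Polynomial.eval_mul, Polynomial.eval_X, Polynomial.eval_one,
      Polynomial.eval_ofNat]
    gcongr

end ParamGames

namespace ParamGames

noncomputable section

variable {q p t : Pol} {n : ℕ}

/-! ### Composition with a second-order function -/

theorem mem_infvar_plays {rec : Bool} {s : List SofMove}
    (hs : s ∈ (sofGame q p).legal n) (he : Even s.length) (hf : Follows (fun _ => false) s)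
    {a : List Bool} (ha : restrictRight s = [none, some a]) :
    wrap s ++ [outMove (certificate rec (t n) s)] ∈ (infvar q p t rec).plays n := by
  refine Or.inr ⟨wrap s, _, infNext_eq_some.2 ⟨s, rfl, ⟨hs, he, hf⟩, ?_⟩, rfl⟩
  obtain ⟨u, rfl⟩ := sof_ends_with_answer hs he ha
  rw [infReply, sofReply_append_singleton]
  rfl

theorem observation_mem_compPlays {rec : Bool} {f : Strategy (sofGame q p)} {s : List SofMove}
    (hs : s ∈ f.plays n) (hf : Follows (fun _ => false) s) {a : List Bool}
    (ha : restrictRight s = [none, some a]) :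
    observation (Pol.ofPolynomial 0) t [] (certificate rec (t n) s) ∈
      compPlays (oracle (Pol.ofPolynomial 0)) (bang (Pol.ofPolynomial 1) (sofGame q p))
        (ternaryGame t) (bangPlays (Pol.ofPolynomial 1) (sofGame q p) n (f.plays n))
        ((infvar q p t rec).plays n) := by
  have hl := f.legal_of_mem_plays hs
  refine ⟨_, mem_infvar_plays hl (f.even_of_mem_plays hs) hf ha, ?_, ?_⟩
  · have e : restrictLeft (restrictRight (wrap s ++ [outMove (certificate rec (t n) s)])) =
        s.map fun m => (0, m) := by
      simp [wrap, openMove, outMove]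
    rw [e]
    refine ⟨bang_legal_of_sof hl, fun i => ?_⟩
    rcases i with _ | i
    · rw [thread_zero_map]
      exact hs
    · rw [thread_succ_map]
      exact Or.inl rfl
  · have e : (s.map callMove).filterMap (Sum.elim
        (fun e : Option Bool => some (Sum.inl e : Option Bool ⊕ Option (List (Option Bool))))
        (Sum.elim (fun _ => none) (fun h => some (Sum.inr h)))) = [] := by
      rw [List.filterMap_map, List.filterMap_eq_nil_iff]
      intro m _
      rfl
    rw [List.filterMap_append, wrap, List.filterMap_cons]
    simp only [openMove, outMove, Sum.elim_inr]
    erw [e]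
    rfl

theorem probObserve_nonneg (r : Pol)
    (τ : Set (List (lolli (oracle r) (ternaryGame t)).Move)) (a : List (Option Bool)) :
    0 ≤ probObserve r t n τ a := by
  refine Finset.sum_nonneg fun k _ => Finset.sum_nonneg fun b _ => ?_
  split_ifs
  · positivity
  · exact le_rfl

/-- Without oracle bits, the probability of an answer is one if the strategy gives it. -/
theorem probObserve_eq_one
    {τ : Set (List (lolli (oracle (Pol.ofPolynomial 0)) (ternaryGame t)).Move)}
    {a : List (Option Bool)} (h : observation (Pol.ofPolynomial 0) t [] a ∈ τ) :
    probObserve (Pol.ofPolynomial 0) t n τ a = 1 := by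
  have h0 : (Pol.ofPolynomial 0) n + 1 = 1 := by simp [Pol.ofPolynomial]
  unfold probObserve
  rw [h0, Finset.sum_range_one, Fintype.sum_unique, if_pos]
  · simp
  · simpa using h

/-- The answer of a completed run is a partial function of small variance and domain. -/
theorem certificate_spec {f : Strategy (sofGame q p)}
    {F : ∀ n, (List.Vector Bool n → Bool) → List.Vector Bool (p n)} (hF : f.Computes F)
    (hn : t n ∣ 2 ^ n) {ε δ : ℝ} (hε : 0 < ε) (hδ : 0 < δ) (hδ1 : δ < 1) {s : List SofMove}
    (hs : s ∈ f.plays n)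
    (hs' : restrictLeft s ∈ bangPlays q predGame n (predPlays fun _ : List.Vector Bool n => false))
    (ha : restrictRight s = [none, some (F n fun _ : List.Vector Bool n => false).toList]) :
    ∃ g : Fin (t n) → Option Bool,
      List.ofFn g = certificate (decide (ε ≤ 1)) (t n) s ∧
      variance (pushforward (extension hn) (semiUniform g)) (F n) ≤ ε ∧
      (domCard g : ℝ) ≤ 1 * (p n * (q n : ℝ) ^ 2 / (δ * ε)) := by
  have hl := f.legal_of_mem_plays hs
  by_cases hc : ε ≤ 1 ∧ finalAnswer s ≠ []
  · refine ⟨markFun (t n) (queries s), ?_, ?_, ?_⟩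
    · rw [ofFn_markFun, certificate, if_pos]
      simpa using hc
    · rw [variance_markFun hF hn hs hs' ha]
      exact hε.le
    · have h₁ : domCard (markFun (t n) (queries s)) ≤ q n :=
        (domCard_markFun_le _ _).trans (length_queries_le hl)
      -- A nonempty answer means `1 ≤ p n`, without which the bound on the domain would be zero.
      have hp : 1 ≤ p n := by
        obtain ⟨u, rfl⟩ := sof_ends_with_answer hl (f.even_of_mem_plays hs) ha
        have h₂ : (F n fun _ : List.Vector Bool n => false).toList ≠ [] := by
          simpa [finalAnswer] using hc.2
        have h₃ := List.length_pos_iff.2 h₂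
        rwa [List.Vector.toList_length] at h₃
      have hq : q n ≤ p n * q n ^ 2 := by
        nlinarith [Nat.zero_le (q n), Nat.le_self_pow two_ne_zero (q n)]
      have h₂ : (domCard (markFun (t n) (queries s)) : ℝ) ≤ p n * (q n : ℝ) ^ 2 := by
        exact_mod_cast h₁.trans hq
      rw [one_mul, le_div_iff₀ (by positivity)]
      have h₃ : δ * ε ≤ 1 := by nlinarith [hc.1]
      have h₄ : (0 : ℝ) ≤ domCard (markFun (t n) (queries s)) := by positivity
      nlinarith
  · have hd : domCard (fun _ : Fin (t n) => (none : Option Bool)) = 0 := by simp [domCard]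
    refine ⟨fun _ => none, ?_, ?_, ?_⟩
    · rw [certificate, if_neg]
      · simp
      · simpa using hc
    · by_cases h1 : ε ≤ 1
      -- The answer is empty, so that `F n` takes values in a one-element type.
      · have hp : F n = fun _ => F n fun _ : List.Vector Bool n => false := by
          have h₀ : finalAnswer s = [] := by
            by_contra h
            exact hc ⟨h1, h⟩
          obtain ⟨u, rfl⟩ := sof_ends_with_answer hl (f.even_of_mem_plays hs) ha
          have h₂ : (F n fun _ : List.Vector Bool n => false).toList = [] := by
            simpa [finalAnswer] using h₀
          have h₃ : p n = 0 := by
            have := congrArg List.length h₂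
            rwa [List.Vector.toList_length] at this
          funext φ
          refine List.Vector.toList_injective ?_
          rw [h₂, ← List.length_eq_zero_iff, List.Vector.toList_length, h₃]
        rw [hp, variance_eq_zero _ fun _ _ => rfl]
        exact hε.le
      -- Here `ε > 1`, and no partial function with nonempty domain need be small enough.
      · exact (variance_none_le_one hn _).trans (not_le.1 h1).le
    · rw [hd]
      push_cast
      positivity

end

end ParamGames

open ParamGames in
open scoped Classical in
theorem mainTheorem3 :
    ∃ C : ℝ, ∀ (q p t : Pol), t.PolytimeComputable → ∀ ε δ : ℝ, 0 < ε → 0 < δ →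
      ∃ (s r : Polynomial ℕ)
        (infvar : Strategy (lolli (oracle (Pol.ofPolynomial r))
          (lolli (bang (Pol.ofPolynomial s) (sofGame q p)) (ternaryGame t)))),
        infvar.PolytimeComputable ∧
        ∀ (f : Strategy (sofGame q p))
          (F : ∀ n, (List.Vector Bool n → Bool) → List.Vector Bool (p n)),
          f.Computes F →
          ∀ (n : ℕ) (hn : t n ∣ 2 ^ n),
            1 - δ ≤ ∑ g : Fin (t n) → Option Bool,
              if variance (pushforward (extension hn) (semiUniform g)) (F n) ≤ ε ∧
                  (domCard g : ℝ) ≤ C * (p n * (q n : ℝ) ^ 2 / (δ * ε)) then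
                probObserve (Pol.ofPolynomial r) t n
                  (compPlays (oracle (Pol.ofPolynomial r))
                    (bang (Pol.ofPolynomial s) (sofGame q p)) (ternaryGame t)
                    (bangPlays (Pol.ofPolynomial s) (sofGame q p) n (f.plays n))
                    (infvar.plays n))
                  (List.ofFn g)
              else 0 := by
  refine ⟨1, fun q p t ht ε δ hε hδ => ⟨1, 0, infvar q p t (decide (ε ≤ 1)),
    infvar_polytimeComputable ht, fun f F hF n hn => ?_⟩⟩
  have h₀ : ∀ g ∈ (Finset.univ : Finset (Fin (t n) → Option Bool)),
      0 ≤ if variance (pushforward (extension hn) (semiUniform g)) (F n) ≤ ε ∧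
          (domCard g : ℝ) ≤ 1 * (p n * (q n : ℝ) ^ 2 / (δ * ε)) then
        probObserve (Pol.ofPolynomial 0) t n
          (compPlays (oracle (Pol.ofPolynomial 0))
            (bang (Pol.ofPolynomial 1) (sofGame q p)) (ternaryGame t)
            (bangPlays (Pol.ofPolynomial 1) (sofGame q p) n (f.plays n))
            ((infvar q p t (decide (ε ≤ 1))).plays n))
          (List.ofFn g)
      else 0 := by
    intro g _
    split_ifs
    · exact probObserve_nonneg _ _ _
    · exact le_rfl
  rcases le_or_gt 1 δ with hδ1 | hδ1
  · exact le_trans (by linarith) (Finset.sum_nonneg h₀)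
  · -- One answer has probability one already.
    obtain ⟨s, hs, hs', ha⟩ := hF n fun _ => false
    obtain ⟨g, hg, hv, hd⟩ := certificate_spec hF hn hε hδ hδ1 hs hs' ha
    have hf : Follows (fun _ => false) s :=
      follows_of_predPlays (fun _ => rfl) (f.legal_of_mem_plays hs) hs'.2
    refine le_trans ?_ (Finset.single_le_sum h₀ (Finset.mem_univ g))
    rw [if_pos ⟨hv, hd⟩, hg, probObserve_eq_one (observation_mem_compPlays hs hf ha)]
    linarith
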